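/- **Setting.** Fix a finite set $\mathcal G$ of unitary gates, each acting on a fixed number of qubits, whose matrix entries are algebraic numbers (for example Hadamard, $T$ and CNOT). A *verifier* is a family $\{V_x\}_{x\in\{0,1\}^*}$ of quantum circuits with gates from $\mathcal G$ that is polynomial-time uniform (a polynomial-time Turing machine maps $x$ to a description of $V_x$), where $V_x$ acts on $m(|x|)$ qubits holding a classical proof and $k(|x|)$ working qubits initialised to $|0\rangle$, with $k,m:\mathbb N\to\mathbb N$ polynomially bounded. For $w\in\{0,1\}^{m(|x|)}$, $\Pr[V \text{ accepts } (x,w)]$ is the probability that measuring the designated output qubit of $V_x|w\rangle|0^{k(|x|)}\rangle$ in the computational basis gives $1$. A function $c:\mathbb N\to[0,1]$ is *polynomial-time computable* if a polynomial-time Turing machine, on input $(1^n,1^k)$, outputs (in binary) an integer $z\ge 0$ with $|c(n)-z/2^k|\le 2^{-k}$. Let $\mathcal L=(\mathcal L_{yes},\mathcal L_{no})$ be a promise problem, that is, a pair of disjoint subsets of $\{0,1\}^*$. A verifier $V$ is a *PreciseQCMA verifier for $\mathcal L$ with completeness $c$ and soundness $s$* if $c,s:\mathbb N\to[0,1]$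 are polynomial-time computable, there is a polynomially bounded $p:\mathbb N\to\mathbb N$ with $c(n)-s(n)\ge 2^{-p(n)}$ for all $n$, and - for every $x\in\mathcal L_{yes}$ there is $w$ with $\Pr[V\text{ accepts }(x,w)]\ge c(|x|)$; - for every $x\in\mathcal L_{no}$ and every $w$, $\Pr[V\text{ accepts }(x,w)]\le s(|x|)$. $\mathcal L$ is in $\mathsf{PreciseQCMA}$ (over $\mathcal G$) if it has such a verifier for some $c,s$. **Proposition.** Let $\mathcal L\in\mathsf{PreciseQCMA}$. Then there is a PreciseQCMA verifier $V^*$ for $\mathcal L$ (over the same gate set), with some completeness $c$ and soundness $s$, such that: 1. there is a polynomially bounded $p:\mathbb N\to\mathbb N$ with $|c(n)-s(n)|\ge 2^{-p(n)}$ for every $n\in\mathbb N$; 2. for every input $x\in\{0,1\}^*$ (whether or not it satisfies the promise) and every classical witness $w\in\{0,1\}^{m(|x|)}$, either $\Pr[V^*\text{ accepts }(x,w)]\ge c(|x|)$ or $\Pr[V^*\text{ accepts }(x,w)]\le s(|x|)$. -/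

import Mathlib

namespace PreciseQ

noncomputable section

/-- `f` is bounded by a polynomial. -/
def PolyBounded (f : ℕ → ℕ) : Prop :=
  ∃ P : Polynomial ℕ, ∀ n, f n ≤ P.eval n

/-- A sequence of reals in `[0,1]` that is computable in polynomial time: a polynomial-time Turing
machine maps `(1ⁿ, 1ᵏ)` to the binary expansion of a numerator `z` with `|c n - z / 2ᵏ| ≤ 2⁻ᵏ`. -/
def PolyTimeUnitReal (c : ℕ → ℝ) : Prop :=
  (∀ n, 0 ≤ c n ∧ c n ≤ 1) ∧
  ∃ z : ℕ × ℕ → ℕ,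
    Nonempty (Turing.TM2ComputableInPolyTime
      (Computability.encodingProd Computability.unaryEncodingNat
        Computability.unaryEncodingNat).encode
      Computability.encodingNatBool.encode z) ∧
    ∀ n k, |c n - (z (n, k) : ℝ) / 2 ^ k| ≤ 1 / 2 ^ k

/-- A finite set of local quantum gates: unitary matrices, indexed by computational basis states,
all of whose entries are algebraic numbers. -/
structure GateSet where
  /-- number of gates in the set -/
  size : ℕ
  /-- number of qubits a gate acts on -/
  arity : Fin size → ℕ
  /-- matrix of a gate; rows are the outgoing basis states, columns the incoming ones -/
  mat : ∀ g, Matrix (Fin (arity g) → Bool) (Fin (arity g) → Bool) ℂ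
  unitary : ∀ g, mat g ∈ Matrix.unitaryGroup (Fin (arity g) → Bool) ℂ
  algebraic : ∀ g a b, IsAlgebraic ℚ (mat g a b)

/-- A gate of the set placed on distinct wires out of `N`. -/
structure GateApp (G : GateSet) (N : ℕ) where
  gate : Fin G.size
  wires : Fin (G.arity gate) ↪ Fin N

/-- A verification circuit: it acts on `nProof` qubits that hold the classical proof, followed by
`nWork` working qubits, and one of all these qubits is designated as its output. -/
structure Circuit (G : GateSet) where
  nProof : ℕ
  nWork : ℕ
  gates : List (GateApp G (nProof + nWork))
  out : Fin (nProof + nWork)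

/-- Effect of a placed gate on a vector of amplitudes: the gate's matrix on the chosen wires,
tensored with the identity on the others. -/
def GateApp.apply {G : GateSet} {N : ℕ} (g : GateApp G N) (ψ : (Fin N → Bool) → ℂ) :
    (Fin N → Bool) → ℂ :=
  fun b => ∑ a : Fin (G.arity g.gate) → Bool,
    G.mat g.gate (b ∘ g.wires) a * ψ (Function.extend g.wires a b)

/-- The state in which the circuit ends when it is started in `|y⟩|0…0⟩`. -/
def Circuit.finalState {G : GateSet} (V : Circuit G) (y : Fin V.nProof → Bool) :
    (Fin (V.nProof + V.nWork) → Bool) → ℂ :=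
  V.gates.foldl (fun ψ g => g.apply ψ) (Pi.single (Fin.append y (fun _ => false)) 1)

/-- The probability that a measurement of the output qubit in the computational basis, at the end
of the circuit started with the classical proof `y`, yields `1`. -/
def Circuit.acceptProb {G : GateSet} (V : Circuit G) (y : Fin V.nProof → Bool) : ℝ :=
  ∑ b : Fin (V.nProof + V.nWork) → Bool,
    if b V.out = true then ‖V.finalState y b‖ ^ 2 else 0

/-- Self-delimiting unary code of a number inside a description of a circuit. -/
def encodeIndex (G : GateSet) (n : ℕ) : List (Fin G.size ⊕ Bool) :=
  List.replicate n (Sum.inr true) ++ [Sum.inr false]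

/-- Description of a placed gate: its name, followed by its wires in order. -/
def GateApp.encode {G : GateSet} {N : ℕ} (g : GateApp G N) : List (Fin G.size ⊕ Bool) :=
  Sum.inl g.gate :: (List.ofFn fun i => encodeIndex G (g.wires i)).flatten

/-- Description of a circuit as a string over a finite alphabet: the numbers of proof qubits and of
working qubits, the output wire, and the gates in the order in which they are applied. -/
def Circuit.encode {G : GateSet} (V : Circuit G) : List (Fin G.size ⊕ Bool) :=
  encodeIndex G V.nProof ++ encodeIndex G V.nWork ++ encodeIndex G V.out ++
    V.gates.flatMap GateApp.encode

/-- The family `x ↦ V x` is uniform: a polynomial-time Turing machine maps the binary string `x`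
to the description of `V x`. -/
def PolyTimeUniform {G : GateSet} (V : List Bool → Circuit G) : Prop :=
  Nonempty (Turing.TM2ComputableInPolyTime (Computability.encodingList Bool).encode
    (Circuit.encode (G := G)) V)

/-- A promise problem over binary strings. -/
structure PromiseProblem where
  yes : Set (List Bool)
  no : Set (List Bool)
  disjoint : Disjoint yes no

/-- `V` is a verifier for `L` over the gate set `G`, with completeness `c` and soundness `s`, in the
sense of the class `PreciseQCMA(c, s)`. -/
structure IsVerifier (G : GateSet) (L : PromiseProblem) (c s : ℕ → ℝ)
    (V : List Bool → Circuit G) : Prop where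
  polyTime_c : PolyTimeUnitReal c
  polyTime_s : PolyTimeUnitReal s
  gap : ∃ p : ℕ → ℕ, PolyBounded p ∧ ∀ l, c l - s l ≥ 1 / 2 ^ p l
  uniform : PolyTimeUniform V
  qubits : ∃ k m : ℕ → ℕ, PolyBounded k ∧ PolyBounded m ∧
    ∀ x, (V x).nWork = k x.length ∧ (V x).nProof = m x.length
  complete : ∀ x ∈ L.yes, ∃ y, (V x).acceptProb y ≥ c x.length
  sound : ∀ x ∈ L.no, ∀ y, (V x).acceptProb y ≤ s x.length

/-- The class `PreciseQCMA(c, s)` over the gate set `G`. -/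
def PreciseQCMAWith (G : GateSet) (c s : ℕ → ℝ) : Set PromiseProblem :=
  {L | ∃ V : List Bool → Circuit G, IsVerifier G L c s V}

/-- The class `PreciseQCMA` over the gate set `G`: the union of all classes
`PreciseQCMA(c, s)`. -/
def PreciseQCMA (G : GateSet) : Set PromiseProblem :=
  {L | ∃ c s : ℕ → ℝ, L ∈ PreciseQCMAWith G c s}

end

end PreciseQ

/-! The verifier's circuits are kept; only the thresholds change. All entries of the finitely many
gates and their complex conjugates lie in one number field, with a common denominator and a common
bound on their conjugates. An acceptance probability of a circuit with polynomially many qubits and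
gates is therefore an element of that field of height `2 ^ poly`. So is its difference from a dyadic
rational with `q` binary digits. Liouville's inequality (`HeightLE.one_le_norm_mul`) says that such
a difference, if not zero, is at least `2 ^ (-C * q)`, where `C` depends only on the gate set
(`GateSet.exists_separation`).

The old soundness `s₀` may be any computable real, so it is first rounded up to a dyadic `s` with
`q` digits, `q` being a polynomial that exceeds both the circuit size and the exponent of the old
gap. The new completeness is `c = s + 2 ^ (-(q + C * q + 1))`. A probability above `s` is then above
`c`, whether or not the promise holds. Since the old gap is at least `4 * 2 ^ (-q)`, also `s₀ ≤ s <
c ≤ c₀`, and the verifier still decides the same promise problem.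

What remains is that `c` and `s` are polynomial-time computable (`polyTimeUnitReal_round`). For this
an explicit stack machine runs the given machine for `s₀` at precision `q`, adds one, and cuts or
extends the digits to the requested precision. The new digit of `c` lies strictly below the digits
of `s`, so it is appended without any carry. Uniformity bounds the number of gates, because the
output of a polynomial-time machine has polynomial length (`exists_length_encode_le`). -/

namespace PreciseQ

open Turing Computability

/-! ### Runs of bounded length -/

/-- `b` is reached from `a` by at most `t` iterations of the partial map `f`. -/
def Within {α : Type*} (f : α → Option α) (t : ℕ) (a b : α) : Prop :=
  ∃ s ≤ t, (flip bind f)^[s] (some a) = some b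

theorem Within.refl {α : Type*} {f : α → Option α} (a : α) : Within f 0 a a := ⟨0, le_rfl, rfl⟩

theorem Within.mono {α : Type*} {f : α → Option α} {t t' : ℕ} {a b : α} (h : Within f t a b)
    (ht : t ≤ t') : Within f t' a b :=
  let ⟨s, hs, h⟩ := h; ⟨s, hs.trans ht, h⟩

theorem Within.trans {α : Type*} {f : α → Option α} {t t' : ℕ} {a b c : α}
    (h : Within f t a b) (h' : Within f t' b c) : Within f (t + t') a c := by
  obtain ⟨s, hs, h⟩ := h
  obtain ⟨s', hs', h'⟩ := h'
  refine ⟨s' + s, by omega, ?_⟩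
  rw [Function.iterate_add_apply, h, h']

theorem Within.head {α : Type*} {f : α → Option α} {t : ℕ} {a b c : α}
    (h : f a = some b) (h' : Within f t b c) : Within f (t + 1) a c := by
  have h1 : Within f 1 a b := ⟨1, le_rfl, h⟩
  exact (h1.trans h').mono (by omega)

theorem Within.single {α : Type*} {f : α → Option α} {a b : α}
    (h : f a = some b) : Within f 1 a b := ⟨1, le_rfl, h⟩

/-! ### Arithmetic on lists of binary digits, lowest digit first -/

/-- Little-endian binary addition of a carry bit. -/
def incr : Bool → List Bool → List Bool
  | true, [] => [true]
  | false, [] => []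
  | c, b :: l => (b ^^ c) :: incr (b && c) l

theorem incr_cons (c b : Bool) (l : List Bool) :
    incr c (b :: l) = (b ^^ c) :: incr (b && c) l := by
  cases c <;> rfl

theorem encodePosNum_eq_bits (p : PosNum) : encodePosNum p = (p : ℕ).bits := by
  induction p with
  | one => simp [encodePosNum]
  | bit0 p ih =>
    rw [encodePosNum, ih, PosNum.cast_bit0, ← two_mul, Nat.bit0_bits _ (PosNum.cast_pos p).ne']
  | bit1 p ih =>
    rw [encodePosNum, ih, PosNum.cast_bit1, ← two_mul, Nat.bit1_bits]

theorem encodeNat_eq_bits (n : ℕ) : encodeNat n = n.bits := by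
  unfold encodeNat
  have h : ((n : Num) : ℕ) = n := Num.to_of_nat n
  cases hn : (n : Num) with
  | zero => rw [hn] at h; rw [← h]; simp [encodeNum]
  | pos p => rw [hn] at h; rw [← h, encodeNum, encodePosNum_eq_bits]; rfl

theorem incr_false (l : List Bool) : incr false l = l := by
  induction l with
  | nil => rfl
  | cons b l ih => simp [incr, ih]

theorem incr_true_bits (n : ℕ) : incr true n.bits = (n + 1).bits := by
  induction n using Nat.strong_induction_on with
  | _ n ih =>
    rcases Nat.even_or_odd' n with ⟨m, rfl | rfl⟩
    · rcases Nat.eq_zero_or_pos m with rfl | hm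
      · simp [incr]
      · rw [Nat.bit0_bits _ hm.ne', Nat.bit1_bits]
        simp [incr, incr_false]
    · rw [Nat.bit1_bits, show 2 * m + 1 + 1 = 2 * (m + 1) by ring,
        Nat.bit0_bits _ (Nat.succ_ne_zero m), ← ih m (by omega)]
      simp [incr]

theorem drop_bits (j n : ℕ) : n.bits.drop j = (n / 2 ^ j).bits := by
  induction j generalizing n with
  | zero => simp
  | succ j ih =>
    rw [← List.drop_tail, ← Nat.div2_bits_eq_tail, ih, Nat.div2_val, Nat.div_div_eq_div_mul, pow_succ']

theorem length_bits_le {n j : ℕ} (h : n < 2 ^ j) : n.bits.length ≤ j := by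
  rw [← List.drop_eq_nil_iff, drop_bits, Nat.div_eq_of_lt h, Nat.zero_bits]

theorem length_incr_le (c : Bool) (l : List Bool) : (incr c l).length ≤ l.length + 1 := by
  induction l generalizing c with
  | nil => cases c <;> simp [incr]
  | cons b l ih => simpa [incr] using ih _

/-- Prepend `m` digits, which are taken from `w` as long as that is not exhausted, and are zeros
from then on. -/
def padDigits : ℕ → List Bool → List Bool → List Bool
  | 0, _, l => l
  | m + 1, w, l => padDigits m w.tail (w.headD false :: l)

/-- Each prepended digit doubles the number and adds the digit, so `b`, prepended after `t` zeros,
is doubled `m - t - 1` times. Positivity of `n` is essential: `Nat.bits 0` is empty, and a zero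
prepended to it would not be a canonical expansion. The machine meets this condition because it pads
`z + 1`. -/
theorem padDigits_replicate (m t : ℕ) (b : Bool) {n : ℕ} (hn : 0 < n) :
    padDigits m (List.replicate t false ++ [b]) n.bits =
      (n * 2 ^ m + if t < m then b.toNat * 2 ^ (m - t - 1) else 0).bits := by
  have nil : ∀ (m n : ℕ), 0 < n → padDigits m [] n.bits = (n * 2 ^ m).bits := by
    intro m
    induction m with
    | zero => intro n _; simp [padDigits]
    | succ m ih =>
      intro n hn
      rw [padDigits, List.tail_nil, List.headD_nil, ← Nat.bit0_bits _ hn.ne', ih _ (by omega)]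
      congr 1; ring
  induction m generalizing t n with
  | zero => simp [padDigits]
  | succ m ih =>
    cases t with
    | zero =>
      cases b
      · simp only [padDigits, List.replicate_zero, List.nil_append, List.tail_cons, List.headD_cons]
        rw [← Nat.bit0_bits _ hn.ne', nil _ _ (by omega)]
        congr 1; simp; ring
      · simp only [padDigits, List.replicate_zero, List.nil_append, List.tail_cons, List.headD_cons]
        rw [← Nat.bit1_bits, nil _ _ (by omega)]
        congr 1; simp; ring
    | succ t =>
      simp only [padDigits, List.replicate_succ, List.cons_append, List.tail_cons, List.headD_cons]
      rw [← Nat.bit0_bits _ hn.ne', ih _ (by omega)]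
      congr 1
      simp only [Nat.add_lt_add_iff_right, show m + 1 - (t + 1) - 1 = m - t - 1 by omega]
      ring

/-! ### Stacks and labels of the threshold machine -/

/-- Work stacks of the threshold machine. -/
inductive Reg
  | inp | cnt | cnt' | acc | acc' | prec | pos | digits | out
  deriving DecidableEq

instance : Fintype Reg where
  elems := {.inp, .cnt, .cnt', .acc, .acc', .prec, .pos, .digits, .out}
  complete r := by cases r <;> decide

/-- Alphabets of the work stacks. -/
abbrev RegΓ : Reg → Type
  | .inp => Bool ⊕ Bool
  | _ => Bool

/-- The contents of all work stacks. -/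
def regs (inp : List (Bool ⊕ Bool)) (cnt cnt' acc acc' prec pos digits out : List Bool) :
    ∀ r, List (RegΓ r)
  | .inp => inp
  | .cnt => cnt
  | .cnt' => cnt'
  | .acc => acc
  | .acc' => acc'
  | .prec => prec
  | .pos => pos
  | .digits => digits
  | .out => out

section regs
variable (inp : List (Bool ⊕ Bool)) (cnt cnt' acc acc' prec pos digits out l : List Bool)
  (l' : List (Bool ⊕ Bool))

theorem update_inp : Function.update (regs inp cnt cnt' acc acc' prec pos digits out) .inp l' =
    regs l' cnt cnt' acc acc' prec pos digits out := by
  funext r; cases r <;> rfl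

theorem update_cnt : Function.update (regs inp cnt cnt' acc acc' prec pos digits out) .cnt l =
    regs inp l cnt' acc acc' prec pos digits out := by
  funext r; cases r <;> rfl

theorem update_cnt' : Function.update (regs inp cnt cnt' acc acc' prec pos digits out) .cnt' l =
    regs inp cnt l acc acc' prec pos digits out := by
  funext r; cases r <;> rfl

theorem update_acc : Function.update (regs inp cnt cnt' acc acc' prec pos digits out) .acc l =
    regs inp cnt cnt' l acc' prec pos digits out := by
  funext r; cases r <;> rfl

theorem update_acc' : Function.update (regs inp cnt cnt' acc acc' prec pos digits out) .acc' l =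
    regs inp cnt cnt' acc l prec pos digits out := by
  funext r; cases r <;> rfl

theorem update_prec : Function.update (regs inp cnt cnt' acc acc' prec pos digits out) .prec l =
    regs inp cnt cnt' acc acc' l pos digits out := by
  funext r; cases r <;> rfl

theorem update_pos : Function.update (regs inp cnt cnt' acc acc' prec pos digits out) .pos l =
    regs inp cnt cnt' acc acc' prec l digits out := by
  funext r; cases r <;> rfl

theorem update_digits :
    Function.update (regs inp cnt cnt' acc acc' prec pos digits out) .digits l =
    regs inp cnt cnt' acc acc' prec pos l out := by
  funext r; cases r <;> rfl

theorem update_out : Function.update (regs inp cnt cnt' acc acc' prec pos digits out) .out l =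
    regs inp cnt cnt' acc acc' prec pos digits l := by
  funext r; cases r <;> rfl

end regs

/-- Labels of the threshold machine, which runs a machine with labels `Λ` as a subroutine. -/
inductive Lbl (Λ : Type) (e : ℕ)
  | read | mul (i : Fin (e + 1)) | copy (i : Fin (e + 1)) | restore (i : Fin (e + 1))
  | back (i : Fin (e + 1)) | fillPos | fillCnt | run (l : Λ) | inc (c : Bool) | rev | drop | pad
  | clear
  deriving Fintype

/-- Alphabets of the stacks of a subroutine together with the work stacks. -/
abbrev StkΓ {K : Type} (Γ : K → Type) : K ⊕ Reg → Type
  | .inl k => Γ k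
  | .inr r => RegΓ r

/-- Combine the stacks of a subroutine with the work stacks. -/
def stk {K : Type} {Γ : K → Type} (S : ∀ k, List (Γ k)) (R : ∀ r, List (RegΓ r)) :
    ∀ k : K ⊕ Reg, List (StkΓ Γ k)
  | .inl k => S k
  | .inr r => R r

section stk
variable {K : Type} [DecidableEq K] {Γ : K → Type} (S : ∀ k, List (Γ k)) (R : ∀ r, List (RegΓ r))

theorem update_stk_inl (k : K) (l : List (StkΓ Γ (.inl k))) :
    Function.update (stk S R) (.inl k) l = stk (Function.update S k l) R := by
  funext j
  rcases j with j | r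
  · change _ = Function.update S k l j
    by_cases h : j = k
    · subst h; rw [Function.update_self, Function.update_self]
    · rw [Function.update_of_ne h, Function.update_of_ne (by simpa using h)]; rfl
  · rw [Function.update_of_ne (by simp)]; rfl

theorem update_stk_inr (r : Reg) (l : List (StkΓ Γ (.inr r))) :
    Function.update (stk S R) (.inr r) l = stk S (Function.update R r l) := by
  funext j
  rcases j with j | j
  · rw [Function.update_of_ne (by simp)]; rfl
  · change _ = Function.update R r l j
    by_cases h : j = r
    · subst h; rw [Function.update_self, Function.update_self]
    · rw [Function.update_of_ne h, Function.update_of_ne (by simpa using h)]; rfl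

end stk

/-! ### Running a machine as a subroutine -/

/-- Translate a statement of a subroutine; instead of halting, it jumps to `h`. -/
def liftStmt {K Λ σ Λ' τ : Type} {Γ : K → Type} (f : Λ → Λ') (h : Λ') :
    TM2.Stmt Γ Λ σ → TM2.Stmt (StkΓ Γ) Λ' (σ × τ)
  | .push k g q => .push (.inl k) (fun s => g s.1) (liftStmt f h q)
  | .peek k g q => .peek (.inl k) (fun s o => (g s.1 o, s.2)) (liftStmt f h q)
  | .pop k g q => .pop (.inl k) (fun s o => (g s.1 o, s.2)) (liftStmt f h q)
  | .load g q => .load (fun s => (g s.1, s.2)) (liftStmt f h q)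
  | .branch g q q' => .branch (fun s => g s.1) (liftStmt f h q) (liftStmt f h q')
  | .goto g => .goto (fun s => f (g s.1))
  | .halt => .goto (fun _ => h)

/-- The configuration of a machine that has a configuration of its subroutine embedded. -/
def liftCfg {K Λ σ Λ' τ : Type} {Γ : K → Type} (f : Λ → Λ') (h : Λ') (R : ∀ r, List (RegΓ r))
    (t : τ) (c : TM2.Cfg Γ Λ σ) : TM2.Cfg (StkΓ Γ) Λ' (σ × τ) :=
  ⟨some (c.l.elim h f), (c.var, t), stk c.stk R⟩

theorem stepAux_liftStmt {K Λ σ Λ' τ : Type} [DecidableEq K] {Γ : K → Type} (f : Λ → Λ') (h : Λ')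
    (R : ∀ r, List (RegΓ r)) (t : τ) (q : TM2.Stmt Γ Λ σ) (v : σ) (S : ∀ k, List (Γ k)) :
    TM2.stepAux (liftStmt f h q) (v, t) (stk S R) = liftCfg f h R t (TM2.stepAux q v S) := by
  induction q generalizing v S with
  | push k g q ih => simp only [liftStmt, TM2.stepAux, update_stk_inl, ← ih]; rfl
  | peek k g q ih => simp only [liftStmt, TM2.stepAux, ← ih]; rfl
  | pop k g q ih => simp only [liftStmt, TM2.stepAux, update_stk_inl, ← ih]; rfl
  | load g q ih => simp only [liftStmt, TM2.stepAux, ← ih]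
  | branch g q q' ih ih' =>
    simp only [liftStmt, TM2.stepAux]
    cases g v <;> simp [ih, ih']
  | goto g => rfl
  | halt => rfl

/-- The two machines move in lockstep. A halted configuration becomes the label `h`, from which the
large machine could go on, but the subroutine has no step there, so the induction never needs to
match one. -/
theorem within_liftCfg {K Λ σ Λ' τ : Type} [DecidableEq K] {Γ : K → Type} (f : Λ → Λ') (h : Λ')
    (m : Λ → TM2.Stmt Γ Λ σ) (m' : Λ' → TM2.Stmt (StkΓ Γ) Λ' (σ × τ))
    (hm : ∀ l, m' (f l) = liftStmt f h (m l))
    (R : ∀ r, List (RegΓ r)) (t : τ) {n : ℕ} {a b : TM2.Cfg Γ Λ σ}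
    (hab : Within (TM2.step m) n a b) :
    Within (TM2.step m') n (liftCfg f h R t a) (liftCfg f h R t b) := by
  obtain ⟨s, hs, hab⟩ := hab
  refine ⟨s, hs, ?_⟩
  clear hs
  induction s generalizing b with
  | zero =>
    obtain rfl : a = b := by simpa using hab
    rfl
  | succ s ih =>
    rw [Function.iterate_succ_apply'] at hab ⊢
    cases hc : (flip bind (TM2.step m))^[s] (some a) with
    | none => rw [hc] at hab; cases hab
    | some c =>
      rw [hc] at hab
      rw [ih hc]
      change TM2.step m c = some b at hab
      rw [show ∀ x, flip bind (TM2.step m') (some x) = TM2.step m' x from fun _ => rfl]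
      obtain ⟨l, v, S⟩ := c
      cases l with
      | none => cases hab
      | some l =>
        simp only [TM2.step, Option.some.injEq] at hab
        simp only [liftCfg, Option.elim, TM2.step, hm, stepAux_liftStmt, hab]

/-! ### The program of the threshold machine -/

section machine

variable (M : FinTM2) (e C : ℕ) (b : Bool) (ci : M.Γ M.k₀ ≃ Bool ⊕ Bool) (co : M.Γ M.k₁ ≃ Bool)

/-- Statements of the threshold machine. -/
abbrev MStmt := TM2.Stmt (StkΓ M.Γ) (Lbl M.Λ e) (M.σ × Option Bool)

variable {M e}

/-- Clear the buffer and continue at a label. -/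
def jump (l : Lbl M.Λ e) : MStmt M e := .load (fun s => (s.1, none)) (.goto fun _ => l)

/-- Push `n` zeros to the stack of digits. -/
def pushZeros (n : ℕ) (q : MStmt M e) : MStmt M e :=
  (fun q => .push (.inr .digits) (fun _ => false) q)^[n] q

variable (M e)

/-- The threshold machine. On the input `(1ⁿ, 1ᵏ)` it computes `1 ^ q` with `q = (n + 2) ^ (e + 1)`,
runs `M` on `(1ⁿ, 1 ^ q)`, adds one to the outcome, and then drops low digits or appends further
ones, so that the weight of the lowest digit becomes `2 ^ (-k)`. The digits it appends are `C * q`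
zeros, then `b`, then again zeros. -/
def prog : Lbl M.Λ e → MStmt M e
  | .read =>
    .pop (.inr .inp) (fun s o => (s.1, o.map Sum.isLeft)) <|
    .branch (fun s => s.2.isSome)
      (.branch (fun s => s.2.getD false)
        (.push (.inr .cnt) (fun _ => true) (jump .read))
        (.push (.inr .prec) (fun _ => true) (jump .read)))
      (.push (.inr .acc) (fun _ => true) <| .push (.inr .digits) (fun _ => b) <|
        jump (.mul (Fin.last e)))
  | .mul i =>
    .pop (.inr .acc) (fun s o => (s.1, o)) <|
    .branch (fun s => s.2.isSome)
      (.push (.inr .acc') (fun _ => true) <| .push (.inr .acc') (fun _ => true) <| jump (.copy i))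
      (jump (.back i))
  | .copy i =>
    .pop (.inr .cnt) (fun s o => (s.1, o)) <|
    .branch (fun s => s.2.isSome)
      (.push (.inr .cnt') (fun _ => true) <| .push (.inr .acc') (fun _ => true) <| jump (.copy i))
      (jump (.restore i))
  | .restore i =>
    .pop (.inr .cnt') (fun s o => (s.1, o)) <|
    .branch (fun s => s.2.isSome)
      (.push (.inr .cnt) (fun _ => true) <| jump (.restore i))
      (jump (.mul i))
  | .back i =>
    .pop (.inr .acc') (fun s o => (s.1, o)) <|
    .branch (fun s => s.2.isSome)
      (.push (.inr .acc) (fun _ => true) <| jump (.back i))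
      (if (i : ℕ) = 0 then jump .fillPos
        else jump (.mul ⟨i - 1, (Nat.sub_le _ _).trans_lt i.isLt⟩))
  | .fillPos =>
    .pop (.inr .acc) (fun s o => (s.1, o)) <|
    .branch (fun s => s.2.isSome)
      (.push (.inr .pos) (fun _ => true) <| .push (.inl M.k₀) (fun _ => ci.symm (.inr true)) <|
        pushZeros C <| jump .fillPos)
      (jump .fillCnt)
  | .fillCnt =>
    .pop (.inr .cnt) (fun s o => (s.1, o)) <|
    .branch (fun s => s.2.isSome)
      (.push (.inl M.k₀) (fun _ => ci.symm (.inl true)) <| jump .fillCnt)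
      (jump (.run M.main))
  | .run l => liftStmt .run (.inc true) (M.m l)
  | .inc c =>
    .pop (.inl M.k₁) (fun s o => (s.1, o.map co)) <|
    .branch (fun s => s.2.isSome)
      (.push (.inr .acc) (fun s => s.2.getD false ^^ c) <|
        .branch (fun s => s.2.getD false && c) (jump (.inc true)) (jump (.inc false)))
      (if c then .push (.inr .acc) (fun _ => true) (jump .rev) else jump .rev)
  | .rev =>
    .pop (.inr .acc) (fun s o => (s.1, o)) <|
    .branch (fun s => s.2.isSome)
      (.push (.inr .out) (fun s => s.2.getD false) <| jump .rev)
      (jump .drop)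
  | .drop =>
    .pop (.inr .pos) (fun s o => (s.1, o)) <|
    .branch (fun s => s.2.isSome)
      (.pop (.inr .prec) (fun s o => (s.1, o)) <|
        .branch (fun s => s.2.isSome) (jump .drop) <|
          .pop (.inr .out) (fun s _ => (s.1, none)) <| jump .drop)
      (jump .pad)
  | .pad =>
    .pop (.inr .prec) (fun s o => (s.1, o)) <|
    .branch (fun s => s.2.isSome)
      (.pop (.inr .digits) (fun s o => (s.1, o)) <|
        .push (.inr .out) (fun s => s.2.getD false) <| jump .pad)
      (jump .clear)
  | .clear =>
    .pop (.inr .digits) (fun s o => (s.1, o)) <|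
    .branch (fun s => s.2.isSome) (jump .clear) .halt

/-- The step function of the threshold machine. -/
abbrev mstep := TM2.step (prog M e C b ci co)

variable {M e}

/-- A configuration of the threshold machine. -/
def cfg (l : Lbl M.Λ e) (S : ∀ k, List (M.Γ k)) (R : ∀ r, List (RegΓ r)) :
    TM2.Cfg (StkΓ M.Γ) (Lbl M.Λ e) (M.σ × Option Bool) :=
  ⟨some l, (M.initialState, none), stk S R⟩

theorem stk_inl (S : ∀ k, List (M.Γ k)) (R : ∀ r, List (RegΓ r)) (k) : stk S R (.inl k) = S k := rfl
theorem stk_inr (S : ∀ k, List (M.Γ k)) (R : ∀ r, List (RegΓ r)) (r) : stk S R (.inr r) = R r := rfl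

theorem stepAux_jump (l : Lbl M.Λ e) (v S) :
    TM2.stepAux (jump l) v S = ⟨some l, (v.1, none), S⟩ := rfl

/-- A stack that counts up to `n`. -/
abbrev tally (n : ℕ) : List Bool := List.replicate n true

theorem stepAux_pushZeros (n : ℕ) (q : MStmt M e) (v S) (inp : List (Bool ⊕ Bool))
    (cnt cnt' acc acc' prec pos digits out : List Bool) :
    TM2.stepAux (pushZeros n q) v (stk S (regs inp cnt cnt' acc acc' prec pos digits out)) =
      TM2.stepAux q v
        (stk S (regs inp cnt cnt' acc acc' prec pos (List.replicate n false ++ digits) out)) := by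
  induction n generalizing q digits with
  | zero => rfl
  | succ n ih =>
    rw [pushZeros, Function.iterate_succ_apply, ← pushZeros, ih]
    simp only [TM2.stepAux, update_stk_inr, stk_inr, regs, update_digits]
    rfl

/-! ### Effect and running time of the single phases -/

variable (S : ∀ k, List (M.Γ k)) (inp : List (Bool ⊕ Bool))
  (cnt cnt' acc acc' prec pos digits out : List Bool)

theorem within_read_inl (n : ℕ) :
    Within (mstep M e C b ci co) n
      (cfg .read S (regs (List.replicate n (.inl true) ++ inp) cnt cnt' acc acc' prec pos digits out))
      (cfg .read S (regs inp (tally n ++ cnt) cnt' acc acc' prec pos digits out)) := by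
  induction n generalizing cnt with
  | zero => exact .refl _
  | succ n ih =>
    refine .head (b := cfg .read S (regs (List.replicate n (.inl true) ++ inp) (true :: cnt) cnt'
      acc acc' prec pos digits out)) ?_ ?_
    · simp [cfg, prog, update_stk_inr, stk_inr, regs, update_inp, update_cnt, stepAux_jump,
        List.replicate_succ]
    · convert ih (true :: cnt) using 3
      simp [tally, List.replicate_succ']

theorem within_read_inr (n : ℕ) :
    Within (mstep M e C b ci co) n
      (cfg .read S (regs (List.replicate n (.inr true) ++ inp) cnt cnt' acc acc' prec pos digits out))
      (cfg .read S (regs inp cnt cnt' acc acc' (tally n ++ prec) pos digits out)) := by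
  induction n generalizing prec with
  | zero => exact .refl _
  | succ n ih =>
    refine .head (b := cfg .read S (regs (List.replicate n (.inr true) ++ inp) cnt cnt'
      acc acc' (true :: prec) pos digits out)) ?_ ?_
    · simp [cfg, prog, update_stk_inr, stk_inr, regs, update_inp, update_prec, stepAux_jump,
        List.replicate_succ]
    · convert ih (true :: prec) using 3
      simp [tally, List.replicate_succ']

theorem within_copy (i) (n : ℕ) :
    Within (mstep M e C b ci co) (n + 1)
      (cfg (.copy i) S (regs inp (tally n) cnt' acc acc' prec pos digits out))
      (cfg (.restore i) S (regs inp [] (tally n ++ cnt') acc (tally n ++ acc') prec pos digits out))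
      := by
  induction n generalizing cnt' acc' with
  | zero =>
    refine .single ?_
    simp [cfg, prog, update_stk_inr, stk_inr, regs, update_cnt, stepAux_jump]
  | succ n ih =>
    refine .head (b := cfg (.copy i) S (regs inp (tally n) (true :: cnt') acc (true :: acc') prec
      pos digits out)) ?_ ?_
    · simp [cfg, prog, update_stk_inr, stk_inr, regs, update_cnt, update_cnt', update_acc',
        stepAux_jump, List.replicate_succ]
    · convert ih (true :: cnt') (true :: acc') using 3 <;> simp [tally, List.replicate_succ']

theorem within_restore (i) (n : ℕ) :
    Within (mstep M e C b ci co) (n + 1)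
      (cfg (.restore i) S (regs inp cnt (tally n) acc acc' prec pos digits out))
      (cfg (.mul i) S (regs inp (tally n ++ cnt) [] acc acc' prec pos digits out)) := by
  induction n generalizing cnt with
  | zero =>
    refine .single ?_
    simp [cfg, prog, update_stk_inr, stk_inr, regs, update_cnt', stepAux_jump]
  | succ n ih =>
    refine .head (b := cfg (.restore i) S (regs inp (true :: cnt) (tally n) acc acc' prec
      pos digits out)) ?_ ?_
    · simp [cfg, prog, update_stk_inr, stk_inr, regs, update_cnt, update_cnt',
        stepAux_jump, List.replicate_succ]
    · convert ih (true :: cnt) using 3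
      simp [tally, List.replicate_succ']

/-- Every mark on `acc` yields `n + 2` marks on `acc'`: two are pushed at once, the others while the
counter is moved to `cnt'`, from where it is then restored. -/
theorem within_mul (i) (n j : ℕ) :
    Within (mstep M e C b ci co) (j * (2 * n + 3) + 1)
      (cfg (.mul i) S (regs inp (tally n) [] (tally j) acc' prec pos digits out))
      (cfg (.back i) S (regs inp (tally n) [] [] (tally (j * (n + 2)) ++ acc') prec pos digits out))
      := by
  induction j generalizing acc' with
  | zero =>
    refine .mono (.single ?_) (by omega)
    simp [cfg, prog, update_stk_inr, stk_inr, regs, update_acc, stepAux_jump]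
  | succ j ih =>
    have h1 := within_copy C b ci co S inp [] (tally j) (true :: true :: acc') prec pos digits out
      i n
    have h2 := within_restore C b ci co S inp [] (tally j) (tally n ++ true :: true :: acc') prec
      pos digits out i n
    have h3 := ih (tally n ++ true :: true :: acc')
    rw [List.append_nil] at h1 h2
    refine .mono (.head ?_ ((h1.trans h2).trans ?_)) (t := n + 1 + (n + 1) +
      (j * (2 * n + 3) + 1) + 1) ?_
    · simp [cfg, prog, update_stk_inr, stk_inr, regs, update_acc, update_acc', stepAux_jump,
        List.replicate_succ]
    · convert h3 using 3
      rw [show (j + 1) * (n + 2) = j * (n + 2) + (n + 2) by ring]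
      simp only [tally, List.replicate_add, List.append_assoc]
      rfl
    · apply le_of_eq; ring

theorem within_back (i : Fin (e + 1)) (n : ℕ) :
    Within (mstep M e C b ci co) (n + 1)
      (cfg (.back i) S (regs inp cnt cnt' acc (tally n) prec pos digits out))
      (cfg (if (i : ℕ) = 0 then .fillPos else .mul ⟨i - 1, (Nat.sub_le _ _).trans_lt i.isLt⟩) S
        (regs inp cnt cnt' (tally n ++ acc) [] prec pos digits out)) := by
  induction n generalizing acc with
  | zero =>
    refine .single ?_
    by_cases hi : (i : ℕ) = 0 <;>
    simp [cfg, prog, update_stk_inr, stk_inr, regs, update_acc', stepAux_jump, hi]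
  | succ n ih =>
    refine .head (b := cfg (.back i) S (regs inp cnt cnt' (true :: acc) (tally n) prec
      pos digits out)) ?_ ?_
    · simp [cfg, prog, update_stk_inr, stk_inr, regs, update_acc, update_acc',
        stepAux_jump, List.replicate_succ]
    · convert ih (true :: acc) using 3
      simp [tally, List.replicate_succ']

/-- The label index `i` stands for `i + 1` remaining multiplications by `n + 2`. The final value
dominates all intermediate ones, so each round costs at most three times that value, plus two. -/
theorem within_power (n : ℕ) (i : ℕ) (hi : i < e + 1) (j : ℕ) :
    Within (mstep M e C b ci co) ((i + 1) * (3 * (j * (n + 2) ^ (i + 1)) + 2))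
      (cfg (.mul ⟨i, hi⟩) S (regs inp (tally n) [] (tally j) [] prec pos digits out))
      (cfg .fillPos S
        (regs inp (tally n) [] (tally (j * (n + 2) ^ (i + 1))) [] prec pos digits out)) := by
  induction i generalizing j with
  | zero =>
    have h1 := within_mul C b ci co S inp [] prec pos digits out ⟨0, hi⟩ n j
    have h2 := within_back C b ci co S inp (tally n) [] [] prec pos digits out ⟨0, hi⟩
      (j * (n + 2))
    simp only [List.append_nil, if_true] at h1 h2
    convert (h1.trans h2).mono ?_ using 3
    · simp
    · ring_nf; omega
  | succ i ih =>
    have h1 := within_mul C b ci co S inp [] prec pos digits out ⟨i + 1, hi⟩ n j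
    have h2 := within_back C b ci co S inp (tally n) [] [] prec pos digits out ⟨i + 1, hi⟩
      (j * (n + 2))
    have h3 := ih (by omega) (j * (n + 2))
    have hj : j * (n + 2) * (n + 2) ^ (i + 1) = j * (n + 2) ^ (i + 1 + 1) := by ring
    simp only [List.append_nil, Nat.succ_ne_zero, if_false, Nat.add_sub_cancel, hj] at h1 h2 h3
    refine ((h1.trans h2).trans h3).mono ?_
    have h4 : j * (n + 2) ≤ j * (n + 2) ^ (i + 1 + 1) :=
      Nat.mul_le_mul_left _ (Nat.le_self_pow (by omega) _)
    have h5 : j * (2 * n + 3) ≤ 2 * (j * (n + 2)) := by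
      rw [mul_left_comm]; exact Nat.mul_le_mul_left _ (by omega)
    have h6 : (i + 1 + 1) * (3 * (j * (n + 2) ^ (i + 1 + 1)) + 2) =
      (i + 1) * (3 * (j * (n + 2) ^ (i + 1 + 1)) + 2) + (3 * (j * (n + 2) ^ (i + 1 + 1)) + 2) := by
      ring
    omega

/-- Stacks of the subroutine of which only `k` is not empty. -/
def single (k : M.K) (l : List (M.Γ k)) : ∀ k, List (M.Γ k) := Function.update (fun _ => []) k l

theorem single_self (k : M.K) (l : List (M.Γ k)) : single k l k = l := Function.update_self _ _ _

theorem update_single (k : M.K) (l l' : List (M.Γ k)) :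
    Function.update (single k l) k l' = single k l' := Function.update_idem _ _ _

theorem single_nil (k : M.K) : single k ([] : List (M.Γ k)) = fun _ => [] :=
  Function.update_eq_self _ _

/-- One pass over the marks of `q` serves three purposes: they are kept on `pos` for the later
comparison with `k`, they form the second component of the subroutine's input, and they create the
`C * q` zeros. The second component goes in before the first because a stack is filled from the
bottom. -/
theorem within_fillPos (n : ℕ) (l : List (M.Γ M.k₀)) :
    Within (mstep M e C b ci co) (n + 1)
      (cfg .fillPos (single M.k₀ l) (regs inp cnt cnt' (tally n) acc' prec pos digits out))
      (cfg .fillCnt (single M.k₀ (List.replicate n (ci.symm (.inr true)) ++ l))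
        (regs inp cnt cnt' [] acc' prec (tally n ++ pos)
          (List.replicate (C * n) false ++ digits) out)) := by
  induction n generalizing pos l digits with
  | zero =>
    refine .single ?_
    simp [cfg, prog, update_stk_inr, stk_inr, regs, update_acc, stepAux_jump]
  | succ n ih =>
    refine .head (b := cfg .fillPos (single M.k₀ (ci.symm (.inr true) :: l)) (regs inp cnt cnt'
      (tally n) acc' prec (true :: pos) (List.replicate C false ++ digits) out)) ?_ ?_
    · simp [cfg, prog, update_stk_inr, stk_inr, regs, update_acc, update_pos, update_stk_inl,
        stk_inl, single_self, update_single, stepAux_pushZeros, stepAux_jump, List.replicate_succ]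
    · convert ih (true :: pos) (List.replicate C false ++ digits) (ci.symm (.inr true) :: l) using 3
      · simp [List.replicate_succ']
      · simp [tally, List.replicate_succ']
      · rw [mul_add, mul_one, ← List.append_assoc, List.replicate_append_replicate]

theorem within_fillCnt (n : ℕ) (l : List (M.Γ M.k₀)) :
    Within (mstep M e C b ci co) (n + 1)
      (cfg .fillCnt (single M.k₀ l) (regs inp (tally n) cnt' acc acc' prec pos digits out))
      (cfg (.run M.main) (single M.k₀ (List.replicate n (ci.symm (.inl true)) ++ l))
        (regs inp [] cnt' acc acc' prec pos digits out)) := by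
  induction n generalizing l with
  | zero =>
    refine .single ?_
    simp [cfg, prog, update_stk_inr, stk_inr, regs, update_cnt, stepAux_jump]
  | succ n ih =>
    refine .head (b := cfg .fillCnt (single M.k₀ (ci.symm (.inl true) :: l)) (regs inp (tally n)
      cnt' acc acc' prec pos digits out)) ?_ ?_
    · simp [cfg, prog, update_stk_inr, stk_inr, regs, update_cnt, update_stk_inl,
        stk_inl, single_self, update_single, stepAux_jump, List.replicate_succ]
    · convert ih (ci.symm (.inl true) :: l) using 3
      simp [List.replicate_succ']

theorem within_inc (c : Bool) (l : List Bool) :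
    Within (mstep M e C b ci co) (l.length + 1)
      (cfg (.inc c) (single M.k₁ (l.map co.symm))
        (regs inp cnt cnt' acc acc' prec pos digits out))
      (cfg .rev (fun _ => [])
        (regs inp cnt cnt' ((incr c l).reverse ++ acc) acc' prec pos digits out)) := by
  induction l generalizing c acc with
  | nil =>
    refine .single ?_
    cases c <;> simp [cfg, prog, update_stk_inr, stk_inr, regs, update_acc, update_stk_inl,
        stk_inl, stepAux_jump, single_nil, incr]
  | cons a l ih =>
    refine .head (b := cfg (.inc (a && c)) (single M.k₁ (l.map co.symm)) (regs inp cnt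
      cnt' ((a ^^ c) :: acc) acc' prec pos digits out)) ?_ ?_
    · cases c <;> cases a <;> simp [cfg, prog, update_stk_inr, stk_inr, regs, update_acc,
        update_stk_inl, stk_inl, single_self, update_single, stepAux_jump]
    · convert ih ((a ^^ c) :: acc) (a && c) using 3
      all_goals simp [incr_cons]

theorem within_rev (l : List Bool) :
    Within (mstep M e C b ci co) (l.length + 1)
      (cfg .rev S (regs inp cnt cnt' l acc' prec pos digits out))
      (cfg .drop S (regs inp cnt cnt' [] acc' prec pos digits (l.reverse ++ out))) := by
  induction l generalizing out with
  | nil =>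
    refine .single ?_
    simp [cfg, prog, update_stk_inr, stk_inr, regs, update_acc, stepAux_jump]
  | cons a l ih =>
    refine .head (b := cfg .rev S (regs inp cnt cnt' l acc' prec pos digits (a :: out))) ?_ ?_
    · simp [cfg, prog, update_stk_inr, stk_inr, regs, update_acc, update_out, stepAux_jump]
    · convert ih (a :: out) using 3
      all_goals simp

/-- Popping `pos` and `prec` in parallel computes both truncated differences: a surplus of `pos`
removes low digits, a surplus of `prec` is left over for the padding phase. -/
theorem within_drop (p k : ℕ) :
    Within (mstep M e C b ci co) (p + 1)
      (cfg .drop S (regs inp cnt cnt' acc acc' (tally k) (tally p) digits out))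
      (cfg .pad S (regs inp cnt cnt' acc acc' (tally (k - p)) [] digits (out.drop (p - k)))) := by
  induction p generalizing k out with
  | zero =>
    refine .single ?_
    simp [cfg, prog, update_stk_inr, stk_inr, regs, update_pos, stepAux_jump]
  | succ p ih =>
    cases k with
    | zero =>
      refine .head (b := cfg .drop S (regs inp cnt cnt' acc acc' (tally 0) (tally p) digits
        out.tail)) ?_ ?_
      · simp [cfg, prog, update_stk_inr, stk_inr, regs, update_pos, update_prec, update_out,
          stepAux_jump, List.replicate_succ]
      · convert ih out.tail 0 using 3
        · simp
        · simp
    | succ k =>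
      refine .head (b := cfg .drop S (regs inp cnt cnt' acc acc' (tally k) (tally p) digits
        out)) ?_ ?_
      · simp [cfg, prog, update_stk_inr, stk_inr, regs, update_pos, update_prec, update_out,
          stepAux_jump, List.replicate_succ]
      · convert ih out k using 3
        · simp
        · simp

theorem within_pad (k : ℕ) :
    Within (mstep M e C b ci co) (k + 1)
      (cfg .pad S (regs inp cnt cnt' acc acc' (tally k) pos digits out))
      (cfg .clear S (regs inp cnt cnt' acc acc' [] pos (digits.drop k)
        (padDigits k digits out))) := by
  induction k generalizing digits out with
  | zero =>
    refine .single ?_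
    simp [cfg, prog, update_stk_inr, stk_inr, regs, update_prec, stepAux_jump, padDigits]
  | succ k ih =>
    refine .head (b := cfg .pad S (regs inp cnt cnt' acc acc' (tally k) pos digits.tail
        (digits.headD false :: out))) ?_ ?_
    · cases digits <;> simp [cfg, prog, update_stk_inr, stk_inr, regs, update_prec, update_digits,
        update_out, stepAux_jump, List.replicate_succ]
    · convert ih digits.tail (digits.headD false :: out) using 3
      · simp
      · rfl

/-- Unused digits have to go, since `haltList` demands that all stacks but the output be empty. -/
theorem within_clear (l : List Bool) :
    Within (mstep M e C b ci co) (l.length + 1)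
      (cfg .clear S (regs inp cnt cnt' acc acc' prec pos l out))
      ⟨none, (M.initialState, none), stk S (regs inp cnt cnt' acc acc' prec pos [] out)⟩ := by
  induction l with
  | nil =>
    refine .single ?_
    simp [cfg, prog, update_stk_inr, stk_inr, regs, update_digits]
  | cons a l ih =>
    refine .head (b := cfg .clear S (regs inp cnt cnt' acc acc' prec pos l out)) ?_ ih
    simp [cfg, prog, update_stk_inr, stk_inr, regs, update_digits, stepAux_jump]

end machine

theorem initList_stk (M : FinTM2) (s : List (M.Γ M.k₀)) : (initList M s).stk = single M.k₀ s := by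
  funext k
  by_cases h : k = M.k₀
  · subst h; rw [single_self]; simp [initList]
  · simp [initList, single, h]

theorem haltList_stk (M : FinTM2) (s : List (M.Γ M.k₁)) : (haltList M s).stk = single M.k₁ s := by
  funext k
  by_cases h : k = M.k₁
  · subst h; rw [single_self]; simp [haltList]
  · simp [haltList, single, h]

theorem unaryEncodeNat_eq (n : ℕ) : unaryEncodeNat n = tally n := by
  induction n with
  | zero => rfl
  | succ n ih => rw [unaryEncodeNat, ih]; rfl

theorem encode_unaryPair (n k : ℕ) :
    (encodingProd unaryEncodingNat unaryEncodingNat).encode (n, k) =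
      List.replicate n (.inl true) ++ List.replicate k (.inr true) := by
  change (unaryEncodeNat n).map Sum.inl ++ (unaryEncodeNat k).map Sum.inr = _
  simp [unaryEncodeNat_eq, tally]

/-! ### The complete run -/

section machine

variable (M : FinTM2) (e C : ℕ) (b : Bool) (ci : M.Γ M.k₀ ≃ Bool ⊕ Bool) (co : M.Γ M.k₁ ≃ Bool)

/-- The threshold machine as a bundled machine. -/
def machine : FinTM2 :=
  letI := M.kFin
  letI := M.ΛFin
  letI := M.σFin
  { K := M.K ⊕ Reg
    k₀ := .inr .inp
    k₁ := .inr .out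
    Γ := StkΓ M.Γ
    Λ := Lbl M.Λ e
    main := .read
    σ := M.σ × Option Bool
    initialState := (M.initialState, none)
    Γk₀Fin := inferInstanceAs (Fintype (Bool ⊕ Bool))
    m := prog M e C b ci co }

theorem initList_machine (s : List (Bool ⊕ Bool)) :
    initList (machine M e C b ci co) s =
      cfg .read (fun _ => []) (regs s [] [] [] [] [] [] [] []) := by
  have h : ∀ k, (initList (machine M e C b ci co) s).stk k =
      stk (fun _ => []) (regs s [] [] [] [] [] [] [] []) k := by
    rintro (k | r)
    · rfl
    · cases r <;> rfl
  exact congrArg (fun S => (⟨some .read, (M.initialState, none), S⟩ :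
    TM2.Cfg (StkΓ M.Γ) (Lbl M.Λ e) (M.σ × Option Bool))) (funext h)

theorem haltList_machine (s : List Bool) :
    haltList (machine M e C b ci co) s =
      ⟨none, (M.initialState, none), stk (fun _ => []) (regs [] [] [] [] [] [] [] [] s)⟩ := by
  have h : ∀ k, (haltList (machine M e C b ci co) s).stk k =
      stk (fun _ => []) (regs [] [] [] [] [] [] [] [] s) k := by
    rintro (k | r)
    · rfl
    · cases r <;> rfl
  exact congrArg (fun S => (⟨none, (M.initialState, none), S⟩ :
    TM2.Cfg (StkΓ M.Γ) (Lbl M.Λ e) (M.σ × Option Bool))) (funext h)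

/-- With the weight `2 ^ (-k)` for the lowest digit, the number of which the binary expansion ends
with `z + 1` at the weight `2 ^ (-q)`, followed by `C * q` zeros and the digit `b`; further digits
are cut off. -/
def numer (q z k : ℕ) : ℕ :=
  if k ≤ q then (z + 1) / 2 ^ (q - k)
  else (z + 1) * 2 ^ (k - q) + if C * q < k - q then b.toNat * 2 ^ (k - q - C * q - 1) else 0

theorem padDigits_eq_encodeNat (q z k : ℕ) :
    padDigits (k - q) (List.replicate (C * q) false ++ [b])
      ((incr true (encodeNat z)).drop (q - k)) = encodeNat (numer C b q z k) := by
  rw [encodeNat_eq_bits, encodeNat_eq_bits, incr_true_bits, drop_bits, numer]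
  split_ifs with h h'
  · rw [Nat.sub_eq_zero_of_le h]; rfl
  · rw [Nat.sub_eq_zero_of_le (by omega : q ≤ k), pow_zero, Nat.div_one,
      padDigits_replicate _ _ _ (Nat.succ_pos z), if_pos h']
  · rw [Nat.sub_eq_zero_of_le (by omega : q ≤ k), pow_zero, Nat.div_one,
      padDigits_replicate _ _ _ (Nat.succ_pos z), if_neg h']

theorem within_machine (n k z t : ℕ) (hz : z < 2 ^ ((n + 2) ^ (e + 1) + 1))
    (hM : Within M.step t
      (initList M (((encodingProd unaryEncodingNat unaryEncodingNat).encode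
        (n, (n + 2) ^ (e + 1))).map ci.symm))
      (haltList M ((encodeNat z).map co.symm))) :
    Within (machine M e C b ci co).step
      (t + (5 * e + C + 30) * (n + k + 2) ^ (e + 1))
      (initList (machine M e C b ci co)
        ((encodingProd unaryEncodingNat unaryEncodingNat).encode (n, k)))
      (haltList (machine M e C b ci co)
        (encodeNat (numer C b ((n + 2) ^ (e + 1)) z k))) := by
  rw [initList_machine, haltList_machine, encode_unaryPair, ← padDigits_eq_encodeNat]
  rw [encode_unaryPair, List.map_append, List.map_replicate, List.map_replicate] at hM
  generalize hq : (n + 2) ^ (e + 1) = q at *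
  have h1 := within_read_inl (e := e) C b ci co (fun _ => [])
    (List.replicate k (.inr true)) [] [] [] [] [] [] [] [] n
  have h2 := within_read_inr (e := e) C b ci co (fun _ => [])
    [] (tally n) [] [] [] [] [] [] [] k
  have h3 : Within (mstep M e C b ci co) 1
      (cfg .read (fun _ => []) (regs [] (tally n) [] [] [] (tally k) [] [] []))
      (cfg (.mul (Fin.last e)) (fun _ => [])
        (regs [] (tally n) [] (tally 1) [] (tally k) [] [b] [])) := by
    refine .single ?_
    simp [cfg, prog, update_stk_inr, stk_inr, regs, update_inp, update_acc, update_digits,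
      stepAux_jump, tally]
  have h4 := within_power C b ci co (fun _ => []) [] (tally k) [] [b] [] n e (Nat.lt_succ_self e) 1
  have h5 := within_fillPos (e := e) C b ci co [] (tally n) [] [] (tally k) [] [b] [] q []
  have h6 := within_fillCnt (e := e) C b ci co [] [] [] [] (tally k) (tally q)
    (List.replicate (C * q) false ++ [b]) [] n (List.replicate q (ci.symm (.inr true)))
  have h7 := within_liftCfg (τ := Option Bool) (Lbl.run (e := e)) (.inc true) M.m
    (prog M e C b ci co) (fun _ => rfl) (regs [] [] [] [] [] (tally k) (tally q)
    (List.replicate (C * q) false ++ [b]) []) none hM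
  have h8 := within_inc (e := e) C b ci co [] [] [] [] [] (tally k) (tally q)
    (List.replicate (C * q) false ++ [b]) [] true (encodeNat z)
  have h9 := within_rev (e := e) C b ci co (fun _ => []) [] [] [] [] (tally k) (tally q)
    (List.replicate (C * q) false ++ [b]) [] (incr true (encodeNat z)).reverse
  have h10 := within_drop (e := e) C b ci co (fun _ => []) [] [] [] [] []
    (List.replicate (C * q) false ++ [b]) (incr true (encodeNat z)) q k
  have h11 := within_pad (e := e) C b ci co (fun _ => []) [] [] [] [] [] []
    (List.replicate (C * q) false ++ [b]) ((incr true (encodeNat z)).drop (q - k)) (k - q)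
  have h12 := within_clear (e := e) C b ci co (fun _ => []) [] [] [] [] [] [] []
    (padDigits (k - q) (List.replicate (C * q) false ++ [b])
      ((incr true (encodeNat z)).drop (q - k)))
    ((List.replicate (C * q) false ++ [b]).drop (k - q))
  rw [one_mul, hq] at h4
  simp only [single_nil, List.append_nil, List.reverse_reverse] at *
  -- The lifted run fits between the phases before and after it because both `initList` and
  -- `haltList` have the initial internal state.
  have hs : liftCfg (τ := Option Bool) (Lbl.run (e := e)) (.inc true) (regs [] [] [] [] []
      (tally k) (tally q) (List.replicate (C * q) false ++ [b]) []) none (initList M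
        (List.replicate n (ci.symm (.inl true)) ++ List.replicate q (ci.symm (.inr true)))) =
      cfg (.run M.main) (single M.k₀ (List.replicate n (ci.symm (.inl true)) ++
        List.replicate q (ci.symm (.inr true)))) (regs [] [] [] [] []
      (tally k) (tally q) (List.replicate (C * q) false ++ [b]) []) := by
    rw [← initList_stk]; rfl
  have he : liftCfg (τ := Option Bool) (Lbl.run (e := e)) (.inc true) (regs [] [] [] [] []
      (tally k) (tally q) (List.replicate (C * q) false ++ [b]) []) none
        (haltList M ((encodeNat z).map co.symm)) =
      cfg (.inc true) (single M.k₁ ((encodeNat z).map co.symm)) (regs [] [] [] [] []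
      (tally k) (tally q) (List.replicate (C * q) false ++ [b]) []) := by
    rw [← haltList_stk]; rfl
  rw [hs, he] at h7
  have key := h1.trans <| h2.trans <| h3.trans <| h4.trans <| h5.trans <| h6.trans <|
    h7.trans <| h8.trans <| h9.trans <| h10.trans <| h11.trans h12
  refine key.mono ?_
  -- The bound on `z` enters only here: it makes the phases that scan the outcome linear in `q`.
  have l1 : (encodeNat z).length ≤ q + 1 := by
    rw [encodeNat_eq_bits]; exact length_bits_le hz
  have l2 : (incr true (encodeNat z)).reverse.length ≤ q + 2 := by
    rw [List.length_reverse]; exact (length_incr_le _ _).trans (by omega)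
  have l3 : ((List.replicate (C * q) false ++ [b]).drop (k - q)).length ≤ C * q + 1 := by
    simp
  have hqQ : q ≤ (n + k + 2) ^ (e + 1) := hq ▸ Nat.pow_le_pow_left (by omega) _
  have hL : n + k + 2 ≤ (n + k + 2) ^ (e + 1) := Nat.le_self_pow (by omega) _
  generalize (n + k + 2) ^ (e + 1) = Q at *
  have m1 : (e + 1) * (3 * q + 2) ≤ (e + 1) * (5 * Q) := Nat.mul_le_mul_left _ (by omega)
  have m2 : C * q ≤ C * Q := Nat.mul_le_mul_left _ hqQ
  have m3 : (5 * e + C + 30) * Q = (e + 1) * (5 * Q) + C * Q + 25 * Q := by ring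
  omega

end machine

/-! ### Polynomial-time computability of the rounded thresholds -/

theorem Within.nonempty_evalsToInTime {α : Type*} {f : α → Option α} {t : ℕ} {a b : α}
    (h : Within f t a b) : Nonempty (StateTransition.EvalsToInTime f a (some b) t) :=
  let ⟨s, hs, h⟩ := h; ⟨⟨⟨s, h⟩, hs⟩⟩

theorem within_of_evalsToInTime {α : Type*} {f : α → Option α} {t : ℕ} {a b : α}
    (h : StateTransition.EvalsToInTime f a (some b) t) : Within f t a b :=
  ⟨h.steps, h.steps_le_m, h.evals_in_steps⟩

theorem eval_mono (P : Polynomial ℕ) : Monotone fun n => P.eval n := by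
  intro a b h
  simp only [Polynomial.eval_eq_sum_range]
  gcongr

/-- The inner precision `q` depends on `n` alone, so the subroutine's input has length `n + q`,
which is polynomial in `n + k`. Its time bound has natural coefficients and hence is monotone. -/
theorem polyTime_numer (z : ℕ × ℕ → ℕ) (e C : ℕ) (b : Bool)
    (hz : ∀ n, z (n, (n + 2) ^ (e + 1)) < 2 ^ ((n + 2) ^ (e + 1) + 1))
    (h : TM2ComputableInPolyTime (encodingProd unaryEncodingNat unaryEncodingNat).encode
      encodingNatBool.encode z) :
    Nonempty (TM2ComputableInPolyTime (encodingProd unaryEncodingNat unaryEncodingNat).encode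
      encodingNatBool.encode
      fun p : ℕ × ℕ => numer C b ((p.1 + 2) ^ (e + 1)) (z (p.1, (p.1 + 2) ^ (e + 1))) p.2) := by
  refine ⟨⟨⟨machine h.tm e C b h.inputAlphabet h.outputAlphabet, Equiv.refl _, Equiv.refl _⟩,
    h.time.comp (.X + (.X + 2) ^ (e + 1)) + .C (5 * e + C + 30) * (.X + 2) ^ (e + 1),
    fun p => Classical.choice (Within.nonempty_evalsToInTime ?_)⟩⟩
  obtain ⟨n, k⟩ := p
  have hM := within_of_evalsToInTime (h.outputsFun (n, (n + 2) ^ (e + 1)))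
  convert (within_machine h.tm e C b h.inputAlphabet h.outputAlphabet n k
    (z (n, (n + 2) ^ (e + 1))) _ (hz n) hM).mono ?_ using 2
  · exact congrArg (initList (machine h.tm e C b h.inputAlphabet h.outputAlphabet)) (List.map_id _)
  · exact congrArg (haltList (machine h.tm e C b h.inputAlphabet h.outputAlphabet)) (List.map_id _)
  · rw [encode_unaryPair, encode_unaryPair]
    simp only [List.length_append, List.length_replicate, Polynomial.eval_add,
      Polynomial.eval_comp, Polynomial.eval_mul, Polynomial.eval_pow, Polynomial.eval_X,
      Polynomial.eval_C, Polynomial.eval_ofNat]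
    gcongr
    exact eval_mono _ (by gcongr <;> omega)

/-- Truncating a binary expansion after `k` digits loses at most one unit of the last place kept.
The three cases are a cut among the digits of `z + 1`, no cut at all, and a cut that removes only
the digit `b`. -/
theorem abs_sub_numer_le (q C z k : ℕ) (b : Bool) :
    |(z + 1 : ℝ) / 2 ^ q + (b.toNat : ℝ) / 2 ^ (q + C * q + 1) - (numer C b q z k : ℝ) / 2 ^ k| ≤
      1 / 2 ^ k := by
  have hb : (b.toNat : ℝ) ≤ 1 := by cases b <;> simp
  have hb0 : (0 : ℝ) ≤ b.toNat := Nat.cast_nonneg _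
  rw [numer]
  split_ifs with h h'
  · obtain ⟨d, rfl⟩ := Nat.exists_eq_add_of_le h
    rw [Nat.add_sub_cancel_left]
    have h1 := Nat.div_add_mod (z + 1) (2 ^ d)
    have h2 := Nat.mod_lt (z + 1) (show 0 < 2 ^ d by positivity)
    generalize (z + 1) / 2 ^ d = u at *
    generalize (z + 1) % 2 ^ d = v at *
    have h3 : (z + 1 : ℝ) = 2 ^ d * u + v := by exact_mod_cast h1.symm
    have h4 : (v : ℝ) + 1 ≤ 2 ^ d := by exact_mod_cast h2
    have h5 : (1 : ℝ) / 2 ^ (k + d + C * (k + d) + 1) ≤ 1 / 2 ^ (k + d) :=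
      one_div_le_one_div_of_le (by positivity)
        (pow_le_pow_right₀ (by norm_num) (by omega))
    have h6 : (b.toNat : ℝ) / 2 ^ (k + d + C * (k + d) + 1) ≤ 1 / 2 ^ (k + d) :=
      (div_le_div_of_nonneg_right hb (by positivity)).trans h5
    have h7 : (0 : ℝ) ≤ b.toNat / 2 ^ (k + d + C * (k + d) + 1) := by positivity
    have h8 : (z + 1 : ℝ) / 2 ^ (k + d) - u / 2 ^ k = v / 2 ^ (k + d) := by
      rw [h3, pow_add]; field_simp; ring
    -- The remainder `v` is at most `2 ^ d - 1`, which leaves room for the contribution of `b`.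
    have h9 : (v : ℝ) / 2 ^ (k + d) + 1 / 2 ^ (k + d) ≤ 1 / 2 ^ k := by
      rw [← add_div, pow_add, div_le_div_iff₀ (by positivity) (by positivity)]
      nlinarith [show (0 : ℝ) < 2 ^ k by positivity]
    have h10 : (0 : ℝ) ≤ v / 2 ^ (k + d) := by positivity
    rw [abs_le]
    constructor <;> linarith [show (0 : ℝ) ≤ 1 / 2 ^ k by positivity]
  · obtain ⟨d, hd⟩ := Nat.exists_eq_add_of_lt h'
    have hk : k = q + (C * q + d + 1) := by omega
    rw [show k - q - C * q - 1 = d by omega, show k - q = C * q + d + 1 by omega]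
    have : (z + 1 : ℝ) / 2 ^ q + (b.toNat : ℝ) / 2 ^ (q + C * q + 1) =
        (((z + 1) * 2 ^ (C * q + d + 1) + b.toNat * 2 ^ d : ℕ) : ℝ) / 2 ^ k := by
      rw [hk]; push_cast; rw [add_div _ _ ((2 : ℝ) ^ (q + (C * q + d + 1)))]
      congr 1
      · rw [pow_add _ q]; field_simp
      · rw [show q + (C * q + d + 1) = q + C * q + 1 + d by ring, pow_add _ (q + C * q + 1)]
        field_simp
    rw [this, sub_self, abs_zero]
    positivity
  · obtain ⟨d, rfl⟩ := Nat.exists_eq_add_of_le (by omega : q ≤ k)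
    rw [Nat.add_sub_cancel_left] at *
    have : (z + 1 : ℝ) / 2 ^ q = (((z + 1) * 2 ^ d + 0 : ℕ) : ℝ) / 2 ^ (q + d) := by
      push_cast; rw [pow_add]; field_simp; ring
    rw [this, add_sub_cancel_left, abs_of_nonneg (by positivity)]
    exact (div_le_div_of_nonneg_right hb (by positivity)).trans
      (one_div_le_one_div_of_le (by positivity) (pow_le_pow_right₀ (by norm_num) (by omega)))

/-- Rounding up a polynomial-time computable sequence to polynomially many digits, and adding a
fixed digit further down, gives a polynomial-time computable sequence. -/
theorem polyTimeUnitReal_round (z : ℕ × ℕ → ℕ) (e C : ℕ) (b : Bool)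
    (hz : ∀ n, z (n, (n + 2) ^ (e + 1)) < 2 ^ ((n + 2) ^ (e + 1) + 1))
    (h : Nonempty (TM2ComputableInPolyTime
      (encodingProd unaryEncodingNat unaryEncodingNat).encode encodingNatBool.encode z))
    (c : ℕ → ℝ) (hc : ∀ n, c n = (z (n, (n + 2) ^ (e + 1)) + 1) / 2 ^ ((n + 2) ^ (e + 1)) +
      b.toNat / 2 ^ ((n + 2) ^ (e + 1) + C * (n + 2) ^ (e + 1) + 1))
    (h1 : ∀ n, c n ≤ 1) : PolyTimeUnitReal c := by
  refine ⟨fun n => ⟨?_, h1 n⟩, _, polyTime_numer z e C b hz h.some, fun n k => ?_⟩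
  · rw [hc]; positivity
  · rw [hc]; exact abs_sub_numer_le _ _ _ _ _

/-! ### Output length and circuit size -/

/-- A bound for the number of symbols that a statement pushes. -/
def pushes {K Λ σ : Type} {Γ : K → Type} : TM2.Stmt Γ Λ σ → ℕ
  | .push _ _ q => pushes q + 1
  | .peek _ _ q => pushes q
  | .pop _ _ q => pushes q
  | .load _ q => pushes q
  | .branch _ q q' => pushes q + pushes q'
  | .goto _ => 0
  | .halt => 0

theorem length_stepAux_le {K Λ σ : Type} [DecidableEq K] {Γ : K → Type} (q : TM2.Stmt Γ Λ σ)
    (v : σ) (S : ∀ k, List (Γ k)) (k : K) :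
    ((TM2.stepAux q v S).stk k).length ≤ (S k).length + pushes q := by
  induction q generalizing v S with
  | push j g q ih =>
    rw [TM2.stepAux, pushes]
    refine (ih _ _).trans ?_
    by_cases h : k = j
    · subst h; simp; omega
    · rw [Function.update_of_ne h]; omega
  | peek j g q ih => exact ih _ _
  | pop j g q ih =>
    rw [TM2.stepAux, pushes]
    refine (ih _ _).trans ?_
    by_cases h : k = j
    · subst h; simp
    · rw [Function.update_of_ne h]
  | load g q ih => exact ih _ _
  | branch g q q' ih ih' =>
    rw [TM2.stepAux, pushes]
    cases g v
    · exact (ih' _ _).trans (by omega)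
    · exact (ih _ _).trans (by omega)
  | goto g => exact le_rfl
  | halt => exact le_rfl

theorem length_le_of_within {K Λ σ : Type} [DecidableEq K] {Γ : K → Type}
    (m : Λ → TM2.Stmt Γ Λ σ) {B : ℕ} (hB : ∀ l, pushes (m l) ≤ B) (k : K) {n : ℕ}
    {a c : TM2.Cfg Γ Λ σ} (h : Within (TM2.step m) n a c) :
    (c.stk k).length ≤ (a.stk k).length + B * n := by
  obtain ⟨s, hs, h⟩ := h
  refine le_trans (b := (a.stk k).length + B * s) ?_ (by gcongr)
  clear hs
  induction s generalizing c with
  | zero =>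
    obtain rfl : a = c := by simpa using h
    omega
  | succ s ih =>
    rw [Function.iterate_succ_apply'] at h
    cases hc : (flip bind (TM2.step m))^[s] (some a) with
    | none => rw [hc] at h; cases h
    | some c' =>
      rw [hc] at h
      have h' := ih hc
      change TM2.step m c' = some c at h
      obtain ⟨l, v, S⟩ := c'
      cases l with
      | none => cases h
      | some l =>
        simp only [TM2.step, Option.some.injEq] at h
        rw [← h]
        refine (length_stepAux_le _ _ _ _).trans ?_
        have := hB l
        simp only at h'
        rw [mul_add, mul_one]
        omega

/-- The output of a polynomial-time Turing machine has polynomial length. -/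
theorem exists_length_encode_le {α β αΓ βΓ : Type} {ea : α → List αΓ} {eb : β → List βΓ}
    {f : α → β} (h : TM2ComputableInPolyTime ea eb f) :
    ∃ P : Polynomial ℕ, ∀ a, (eb (f a)).length ≤ P.eval (ea a).length := by
  let M := h.tm
  let := M.ΛFin
  let B := ∑ l, pushes (M.m l)
  have hB : ∀ l, pushes (M.m l) ≤ B := fun l =>
    Finset.single_le_sum (f := fun l => pushes (M.m l)) (fun _ _ => Nat.zero_le _)
      (Finset.mem_univ l)
  -- The summand `.X` covers machines whose output stack is also their input stack.
  refine ⟨.X + .C B * h.time, fun a => ?_⟩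
  have hw : Within (TM2.step M.m) _ _ _ := within_of_evalsToInTime (h.outputsFun a)
  have := length_le_of_within M.m hB M.k₁ hw
  have e1 : ((haltList M (List.map h.outputAlphabet.invFun (eb (f a)))).stk M.k₁).length =
      (eb (f a)).length := by
    rw [haltList_stk, single_self, List.length_map]
  have e2 : ((initList M (List.map h.inputAlphabet.invFun (ea a))).stk M.k₁).length ≤
      (ea a).length := by
    rw [initList_stk]
    by_cases hk : M.k₁ = M.k₀
    · rw [hk, single_self, List.length_map]
    · rw [single, Function.update_of_ne hk]; exact Nat.zero_le _
  rw [← e1]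
  refine this.trans ?_
  simp only [Polynomial.eval_add, Polynomial.eval_X, Polynomial.eval_mul, Polynomial.eval_C]
  gcongr

theorem Circuit.size_le_length_encode {G : GateSet} (V : Circuit G) :
    V.nProof + V.nWork + V.gates.length ≤ V.encode.length := by
  have h : V.gates.length ≤ (V.gates.flatMap GateApp.encode).length := by
    induction V.gates with
    | nil => exact Nat.zero_le _
    | cons g l ih =>
      rw [List.flatMap_cons, List.length_append, List.length_cons]
      have : 1 ≤ g.encode.length := by simp [GateApp.encode]
      omega
  simp only [Circuit.encode, encodeIndex, List.length_append, List.length_replicate]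
  omega

/-- A polynomial-time uniform family of circuits has polynomially many qubits and gates. -/
theorem PolyTimeUniform.exists_size_le {G : GateSet} {V : List Bool → Circuit G}
    (h : PolyTimeUniform V) :
    ∃ P : Polynomial ℕ, ∀ x,
      (V x).nProof + (V x).nWork + (V x).gates.length ≤ P.eval x.length := by
  obtain ⟨P, hP⟩ := exists_length_encode_le h.some
  exact ⟨P, fun x => (V x).size_le_length_encode.trans (hP x)⟩

/-- Every polynomial is dominated by a power of `n + 2`. -/
theorem exists_eval_le_pow (P : Polynomial ℕ) : ∃ e : ℕ, ∀ n, P.eval n ≤ (n + 2) ^ e := by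
  induction P using Polynomial.induction_on' with
  | add p q hp hq =>
    obtain ⟨d, hd⟩ := hp
    obtain ⟨e, he⟩ := hq
    refine ⟨max d e + 1, fun n => ?_⟩
    rw [Polynomial.eval_add, pow_succ]
    have h1 : (n + 2) ^ d ≤ (n + 2) ^ max d e := Nat.pow_le_pow_right (by omega) (le_max_left _ _)
    have h2 : (n + 2) ^ e ≤ (n + 2) ^ max d e := Nat.pow_le_pow_right (by omega) (le_max_right _ _)
    have := hd n
    have := he n
    nlinarith
  | monomial d a =>
    refine ⟨a + d, fun n => ?_⟩
    rw [Polynomial.eval_monomial, pow_add]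
    have h1 : a ≤ (n + 2) ^ a := (Nat.lt_pow_self (by omega)).le
    have h2 : n ^ d ≤ (n + 2) ^ d := Nat.pow_le_pow_left (by omega) d
    gcongr

/-! ### Heights of acceptance probabilities and Liouville's inequality -/

section height

variable {K : Type*} [Field K] [NumberField K]

/-- The complex number `z` is the image of an element of the number field `K` with denominator `D`
all conjugates of which are bounded by `B`. -/
def HeightLE (φ : K →ₐ[ℚ] ℂ) (D B : ℕ) (z : ℂ) : Prop :=
  ∃ x : K, φ x = z ∧ IsIntegral ℤ ((D : K) * x) ∧ ∀ τ : K →ₐ[ℚ] ℂ, ‖τ x‖ ≤ B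

variable {φ : K →ₐ[ℚ] ℂ} {D E B B' : ℕ} {z z' : ℂ}

theorem HeightLE.mono (h : HeightLE φ D B z) (hB : B ≤ B') : HeightLE φ D B' z :=
  let ⟨x, h1, h2, h3⟩ := h
  ⟨x, h1, h2, fun τ => (h3 τ).trans (Nat.cast_le.2 hB)⟩

theorem HeightLE.dvd (h : HeightLE φ D B z) (hD : D ∣ E) : HeightLE φ E B z := by
  obtain ⟨x, h1, h2, h3⟩ := h
  obtain ⟨F, rfl⟩ := hD
  refine ⟨x, h1, ?_, h3⟩
  rw [Nat.cast_mul, mul_comm (D : K), mul_assoc]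
  exact (map_natCast (algebraMap ℤ K) F ▸ isIntegral_algebraMap : IsIntegral ℤ (F : K)).mul h2

theorem HeightLE.mul (h : HeightLE φ D B z) (h' : HeightLE φ E B' z') :
    HeightLE φ (D * E) (B * B') (z * z') := by
  obtain ⟨x, h1, h2, h3⟩ := h
  obtain ⟨y, k1, k2, k3⟩ := h'
  refine ⟨x * y, by rw [map_mul, h1, k1], ?_, fun τ => ?_⟩
  · rw [Nat.cast_mul, mul_mul_mul_comm]; exact h2.mul k2
  · rw [map_mul, norm_mul, Nat.cast_mul]
    exact mul_le_mul (h3 τ) (k3 τ) (norm_nonneg _) (Nat.cast_nonneg _)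

theorem HeightLE.sub (h : HeightLE φ D B z) (h' : HeightLE φ D B' z') :
    HeightLE φ D (B + B') (z - z') := by
  obtain ⟨x, h1, h2, h3⟩ := h
  obtain ⟨y, k1, k2, k3⟩ := h'
  refine ⟨x - y, by rw [map_sub, h1, k1], ?_, fun τ => ?_⟩
  · rw [mul_sub]; exact h2.sub k2
  · rw [map_sub, Nat.cast_add]
    exact (norm_sub_le _ _).trans (add_le_add (h3 τ) (k3 τ))

theorem HeightLE.sum {ι : Type*} [Fintype ι] {f : ι → ℂ} (h : ∀ i, HeightLE φ D B (f i)) :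
    HeightLE φ D (Fintype.card ι * B) (∑ i, f i) := by
  choose x h1 h2 h3 using h
  refine ⟨∑ i, x i, by rw [map_sum]; exact Finset.sum_congr rfl fun i _ => h1 i, ?_, fun τ => ?_⟩
  · rw [Finset.mul_sum]; exact IsIntegral.sum _ fun i _ => h2 i
  · rw [map_sum]
    refine (norm_sum_le_of_le _ fun i _ => h3 i τ).trans ?_
    simp

theorem HeightLE.zero : HeightLE φ D B 0 :=
  ⟨0, map_zero _, by rw [mul_zero]; exact isIntegral_zero, fun τ => by simp⟩

theorem HeightLE.one : HeightLE φ 1 1 1 :=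
  ⟨1, map_one _, by simpa using isIntegral_one, fun τ => by simp⟩

theorem HeightLE.ratio {u v : ℕ} (hv : 0 < v) (huv : u ≤ v) : HeightLE φ v 1 ((u : ℂ) / v) := by
  have hv' : (v : K) ≠ 0 := Nat.cast_ne_zero.2 hv.ne'
  refine ⟨(u : K) / v, by simp, ?_, fun τ => ?_⟩
  · rw [mul_div_cancel₀ _ hv']
    exact map_natCast (algebraMap ℤ K) u ▸ isIntegral_algebraMap
  · rw [map_div₀, map_natCast, map_natCast, norm_div, Complex.norm_natCast, Complex.norm_natCast,
      Nat.cast_one]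
    exact div_le_one_of_le₀ (Nat.cast_le.2 huv) (Nat.cast_nonneg _)

/-- An algebraic number has a nonzero integer multiple that is integral, and it has finitely many
conjugates, whose absolute values can be summed. -/
theorem exists_heightLE (x : K) : ∃ D B : ℕ, 0 < D ∧ HeightLE φ D B (φ x) := by
  obtain ⟨y, hy, h⟩ := ((IsFractionRing.isAlgebraic_iff ℤ ℚ K).2
    (Algebra.IsAlgebraic.isAlgebraic x)).exists_integral_multiple
  refine ⟨y.natAbs, ⌈∑ τ : K →ₐ[ℚ] ℂ, ‖τ x‖⌉₊, Int.natAbs_pos.2 hy, x, rfl, ?_, fun τ => ?_⟩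
  · rw [zsmul_eq_mul] at h
    rcases Int.natAbs_eq y with hy' | hy'
    · rw [hy'] at h; simpa using h
    · rw [hy'] at h; simpa using h.neg
  · exact (Finset.single_le_sum (f := fun τ : K →ₐ[ℚ] ℂ => ‖τ x‖) (fun _ _ => norm_nonneg _)
      (Finset.mem_univ τ)).trans (Nat.le_ceil _)

/-- Liouville's inequality. -/
theorem HeightLE.one_le_norm_mul (h : HeightLE φ D B z) (hz : z ≠ 0) (hD : 0 < D) (hB : 0 < B) :
    1 ≤ ‖z‖ * ((D : ℝ) * B) ^ Module.finrank ℚ K := by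
  obtain ⟨x, rfl, h2, h3⟩ := h
  have hx : (D : K) * x ≠ 0 := by
    refine mul_ne_zero (Nat.cast_ne_zero.2 hD.ne') ?_
    rintro rfl; simp at hz
  -- The norm of the integral element `D * x` is a nonzero rational integer, so the product of all
  -- its conjugates has absolute value at least one. Every conjugate other than the one under `φ` is
  -- then bounded from above.
  have hint : IsIntegral ℤ (Algebra.norm ℚ ((D : K) * x)) := Algebra.isIntegral_norm ℚ h2
  obtain ⟨m, hm⟩ := IsIntegrallyClosed.isIntegral_iff.1 hint
  have hm0 : m ≠ 0 := by
    rintro rfl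
    rw [map_zero] at hm
    exact hx (Algebra.norm_eq_zero_iff.1 hm.symm)
  have hprod := Algebra.norm_eq_prod_embeddings ℚ ℂ ((D : K) * x)
  rw [← hm] at hprod
  have h1 : (1 : ℝ) ≤ ∏ τ : K →ₐ[ℚ] ℂ, ‖τ ((D : K) * x)‖ := by
    rw [← norm_prod, ← hprod]
    simp only [eq_intCast, map_intCast, Complex.norm_intCast]
    exact_mod_cast Int.one_le_abs hm0
  classical
  rw [← Finset.mul_prod_erase _ _ (Finset.mem_univ φ)] at h1
  have hDB : (1 : ℝ) ≤ (D : ℝ) * B := by exact_mod_cast Nat.mul_pos hD hB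
  have hle : ∀ τ : K →ₐ[ℚ] ℂ, ‖τ ((D : K) * x)‖ ≤ (D : ℝ) * B := fun τ => by
    rw [map_mul, map_natCast, norm_mul, Complex.norm_natCast]
    exact mul_le_mul_of_nonneg_left (h3 τ) (Nat.cast_nonneg _)
  have h4 : ∏ τ ∈ Finset.univ.erase φ, ‖τ ((D : K) * x)‖ ≤
      ((D : ℝ) * B) ^ (Module.finrank ℚ K - 1) := by
    refine (Finset.prod_le_prod (fun _ _ => norm_nonneg _) fun τ _ => hle τ).trans ?_
    rw [Finset.prod_const, Finset.card_erase_of_mem (Finset.mem_univ _), Finset.card_univ,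
      AlgHom.card ℚ K ℂ]
  -- A superfluous factor `B` is allowed in, so that the exponent becomes the full degree.
  have h5 : ‖φ ((D : K) * x)‖ ≤ ‖φ x‖ * ((D : ℝ) * B) := by
    rw [map_mul, map_natCast, norm_mul, Complex.norm_natCast, mul_comm]
    refine mul_le_mul_of_nonneg_left ?_ (norm_nonneg _)
    exact_mod_cast Nat.le_mul_of_pos_right _ hB
  have hpos : 0 < Module.finrank ℚ K := Module.finrank_pos
  calc (1 : ℝ) ≤ _ := h1
    _ ≤ (‖φ x‖ * ((D : ℝ) * B)) * ((D : ℝ) * B) ^ (Module.finrank ℚ K - 1) :=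
      mul_le_mul h5 h4 (Finset.prod_nonneg fun _ _ => norm_nonneg _) (by positivity)
    _ = _ := by rw [mul_assoc, ← pow_succ', Nat.sub_add_cancel hpos]

/-- Both `z` and its complex conjugate are of bounded height. -/
def ConjHeightLE (φ : K →ₐ[ℚ] ℂ) (D B : ℕ) (z : ℂ) : Prop :=
  HeightLE φ D B z ∧ HeightLE φ D B (starRingEnd ℂ z)

theorem ConjHeightLE.mul (h : ConjHeightLE φ D B z) (h' : ConjHeightLE φ E B' z') :
    ConjHeightLE φ (D * E) (B * B') (z * z') :=
  ⟨h.1.mul h'.1, by rw [map_mul]; exact h.2.mul h'.2⟩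

theorem ConjHeightLE.sum {ι : Type*} [Fintype ι] {f : ι → ℂ}
    (h : ∀ i, ConjHeightLE φ D B (f i)) :
    ConjHeightLE φ D (Fintype.card ι * B) (∑ i, f i) :=
  ⟨.sum fun i => (h i).1, by rw [map_sum]; exact .sum fun i => (h i).2⟩

variable {G : GateSet}

/-- A new amplitude is a sum of `2 ^ arity` products of a matrix entry and an old amplitude. Hence
one gate costs a factor `D` in the denominator and `A` in the bound. -/
theorem GateApp.heightLE_apply {N : ℕ} (g : GateApp G N) {A : ℕ}
    (hG : ∀ g a b, ConjHeightLE φ D B (G.mat g a b)) (hA : ∀ g, 2 ^ G.arity g * B ≤ A)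
    {ψ : (Fin N → Bool) → ℂ} (hψ : ∀ b, ConjHeightLE φ E B' (ψ b)) (b : Fin N → Bool) :
    ConjHeightLE φ (D * E) (A * B') (g.apply ψ b) := by
  have h := ConjHeightLE.sum fun a => (hG g.gate (b ∘ g.wires) a).mul
    (hψ (Function.extend g.wires a b))
  have hle : Fintype.card (Fin (G.arity g.gate) → Bool) * (B * B') ≤ A * B' := by
    rw [← mul_assoc]
    refine Nat.mul_le_mul_right _ ?_
    simpa using hA g.gate
  exact ⟨h.1.mono hle, h.2.mono hle⟩

theorem heightLE_foldl {N A : ℕ} (l : List (GateApp G N))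
    (hG : ∀ g a b, ConjHeightLE φ D B (G.mat g a b)) (hA : ∀ g, 2 ^ G.arity g * B ≤ A)
    {ψ : (Fin N → Bool) → ℂ} (hψ : ∀ b, ConjHeightLE φ E B' (ψ b)) (b : Fin N → Bool) :
    ConjHeightLE φ (D ^ l.length * E) (A ^ l.length * B')
      (l.foldl (fun ψ g => g.apply ψ) ψ b) := by
  induction l generalizing ψ E B' with
  | nil => simpa using hψ b
  | cons g l ih =>
    have := ih fun b => g.heightLE_apply hG hA hψ b
    rwa [← mul_assoc, ← mul_assoc, ← pow_succ, ← pow_succ] at this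

/-- Squared absolute values are products of amplitudes with their conjugates, which is why
`ConjHeightLE` follows both through the circuit. The power of two counts the basis states. -/
theorem Circuit.heightLE_acceptProb {A : ℕ} (V : Circuit G) (y : Fin V.nProof → Bool)
    (hG : ∀ g a b, ConjHeightLE φ D B (G.mat g a b)) (hA : ∀ g, 2 ^ G.arity g * B ≤ A) :
    HeightLE φ (D ^ V.gates.length * D ^ V.gates.length)
      (2 ^ (V.nProof + V.nWork) * (A ^ V.gates.length * A ^ V.gates.length))
      (V.acceptProb y : ℂ) := by
  have h0 : ∀ b, ConjHeightLE φ 1 1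
      ((Pi.single (Fin.append y (fun _ => false)) 1 :
        (Fin (V.nProof + V.nWork) → Bool) → ℂ) b) := by
    intro b
    rw [Pi.single_apply]
    split_ifs
    · exact ⟨.one, by rw [map_one]; exact .one⟩
    · exact ⟨.zero, by rw [map_zero]; exact .zero⟩
  have h1 : ∀ b, ConjHeightLE φ (D ^ V.gates.length) (A ^ V.gates.length) (V.finalState y b) := by
    intro b
    have := heightLE_foldl V.gates hG hA h0 b
    rwa [mul_one, mul_one] at this
  have h2 : (V.acceptProb y : ℂ) = ∑ b : Fin (V.nProof + V.nWork) → Bool,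
      if b V.out = true then V.finalState y b * starRingEnd ℂ (V.finalState y b) else 0 := by
    rw [Circuit.acceptProb]
    push_cast
    refine Finset.sum_congr rfl fun b _ => ?_
    split_ifs
    · rw [Complex.mul_conj']
      push_cast; rfl
    · simp
  rw [h2]
  have h3 := HeightLE.sum (φ := φ) (D := D ^ V.gates.length * D ^ V.gates.length)
    (B := A ^ V.gates.length * A ^ V.gates.length)
    (f := fun b : Fin (V.nProof + V.nWork) → Bool => if b V.out = true then
      V.finalState y b * starRingEnd ℂ (V.finalState y b) else 0) (fun b => by
      split_ifs
      · exact (h1 b).1.mul (h1 b).2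
      · exact .zero)
  simpa using h3

end height

/-! ### Separation from dyadic rationals -/

/-- The matrix entries of a gate set lie in a number field, with a common denominator and a common
bound for their conjugates. -/
theorem GateSet.exists_numberField (G : GateSet) :
    ∃ (K : IntermediateField ℚ ℂ) (_ : NumberField K) (D B : ℕ), 0 < D ∧
      ∀ g a b, ConjHeightLE K.val D B (G.mat g a b) := by
  let I := Σ g : Fin G.size, (Fin (G.arity g) → Bool) × (Fin (G.arity g) → Bool)
  let f : I × Bool → ℂ := fun i =>
    if i.2 then G.mat i.1.1 i.1.2.1 i.1.2.2 else starRingEnd ℂ (G.mat i.1.1 i.1.2.1 i.1.2.2)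
  have hf : ∀ i, IsIntegral ℚ (f i) := by
    rintro ⟨⟨g, a, b⟩, _ | _⟩
    · exact (G.algebraic g a b).isIntegral.map ((starRingEnd ℂ).toRatAlgHom)
    · exact (G.algebraic g a b).isIntegral
  let K := IntermediateField.adjoin ℚ (Set.range f)
  have : FiniteDimensional ℚ K :=
    IntermediateField.finiteDimensional_adjoin (by rintro _ ⟨i, rfl⟩; exact hf i)
  have hK : NumberField K := ⟨⟩
  have hmem : ∀ i, f i ∈ K := fun i => IntermediateField.subset_adjoin _ _ ⟨i, rfl⟩
  choose D B hD h using fun i => exists_heightLE (φ := K.val) ⟨f i, hmem i⟩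
  have h' : ∀ i, HeightLE K.val (∏ i, D i) (∑ i, B i) (f i) := fun i =>
    ((h i).dvd (Finset.dvd_prod_of_mem D (Finset.mem_univ i))).mono
      (Finset.single_le_sum (f := B) (fun _ _ => Nat.zero_le _) (Finset.mem_univ i))
  exact ⟨K, hK, ∏ i, D i, ∑ i, B i, Finset.prod_pos fun i _ => hD i, fun g a b =>
    ⟨h' (⟨g, a, b⟩, true), h' (⟨g, a, b⟩, false)⟩⟩

/-- Acceptance probabilities of circuits keep away from dyadic rationals. -/
theorem GateSet.exists_separation (G : GateSet) :
    ∃ C : ℕ, ∀ (V : Circuit G) (y : Fin V.nProof → Bool) (q u : ℕ), 0 < q →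
      V.nProof + V.nWork + V.gates.length ≤ q → u ≤ 2 ^ q →
      (u : ℝ) / 2 ^ q < V.acceptProb y →
      (u : ℝ) / 2 ^ q + 1 / 2 ^ (C * q) ≤ V.acceptProb y := by
  obtain ⟨K, hK, D, B, hD, hG⟩ := G.exists_numberField
  -- The added one keeps `A` positive even if there are no gates or `B = 0`.
  let A := ∑ g, 2 ^ G.arity g * B + 1
  have hA : ∀ g, 2 ^ G.arity g * B ≤ A := fun g =>
    (Finset.single_le_sum (f := fun g => 2 ^ G.arity g * B) (fun _ _ => Nat.zero_le _)
      (Finset.mem_univ g)).trans (Nat.le_succ _)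
  have hA0 : 0 < A := Nat.succ_pos _
  -- `(D * D * 2) ^ q` is a common denominator of the probability and the dyadic number. `(2 * (2 *
  -- (A * A))) ^ q` bounds the conjugates of their difference, the extra two absorbing the sum of
  -- the two bounds.
  let F := D * D * 2 * (2 * (2 * (A * A)))
  refine ⟨F * Module.finrank ℚ K, fun V y q u hq hV hu hlt => ?_⟩
  have h1 := V.heightLE_acceptProb y hG hA
  generalize hT : V.gates.length = t at *
  have h2 : HeightLE K.val ((D * D * 2) ^ q) ((2 * (A * A)) ^ q) (V.acceptProb y : ℂ) := by
    refine (h1.dvd ?_).mono ?_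
    · rw [mul_pow, mul_pow, mul_assoc]
      exact mul_dvd_mul (pow_dvd_pow _ (by omega))
        ((pow_dvd_pow _ (by omega)).trans (dvd_mul_right _ _))
    · rw [mul_pow, mul_pow]
      exact Nat.mul_le_mul (Nat.pow_le_pow_right (by omega) (by omega))
        (Nat.mul_le_mul (Nat.pow_le_pow_right hA0 (by omega))
          (Nat.pow_le_pow_right hA0 (by omega)))
  have h3 : HeightLE K.val ((D * D * 2) ^ q) ((2 * (A * A)) ^ q)
      ((u : ℂ) / ((2 ^ q : ℕ) : ℂ)) := by
    refine ((HeightLE.ratio (by positivity) hu).dvd ?_).mono (Nat.one_le_pow _ _ (by positivity))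
    rw [mul_pow]; exact dvd_mul_left _ _
  have h4 : HeightLE K.val ((D * D * 2) ^ q) ((2 * (2 * (A * A))) ^ q)
      ((V.acceptProb y - (u : ℝ) / 2 ^ q : ℝ) : ℂ) := by
    convert (h2.sub h3).mono ?_ using 1
    · push_cast; rfl
    · rw [← two_mul, mul_pow 2 (2 * _)]
      exact Nat.mul_le_mul_right _ (Nat.le_self_pow hq.ne' _)
  have hpos := sub_pos.2 hlt
  have h5 := h4.one_le_norm_mul (by exact_mod_cast hpos.ne') (by positivity) (by positivity)
  rw [Complex.norm_real, Real.norm_of_nonneg hpos.le] at h5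
  have h6 : (((D * D * 2) ^ q : ℕ) : ℝ) * ((2 * (2 * (A * A))) ^ q : ℕ) = (F : ℝ) ^ q := by
    rw [← Nat.cast_mul, ← mul_pow, Nat.cast_pow]
  -- The crude `F ≤ 2 ^ F` turns the bound into a power of two with an integral exponent, without
  -- logarithms.
  have h7 : (F : ℝ) ^ q ≤ (2 ^ F) ^ q :=
    pow_le_pow_left₀ (Nat.cast_nonneg _) (by exact_mod_cast (Nat.lt_two_pow_self).le) _
  have h8 : ((F : ℝ) ^ q) ^ Module.finrank ℚ K ≤ 2 ^ (F * Module.finrank ℚ K * q) := by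
    refine (pow_le_pow_left₀ (by positivity) h7 _).trans (le_of_eq ?_)
    rw [← pow_mul, ← pow_mul]; ring_nf
  rw [h6] at h5
  have h9 : 1 / 2 ^ (F * Module.finrank ℚ K * q) ≤ V.acceptProb y - u / 2 ^ q := by
    rw [div_le_iff₀ (by positivity)]
    exact h5.trans (mul_le_mul_of_nonneg_left h8 hpos.le)
  linarith

end PreciseQ

/-! ### The new thresholds -/

theorem proposition2p4 (G : PreciseQ.GateSet) (L : PreciseQ.PromiseProblem)
    (hL : L ∈ PreciseQ.PreciseQCMA G) :
    ∃ (c s : ℕ → ℝ) (V : List Bool → PreciseQ.Circuit G),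
      PreciseQ.IsVerifier G L c s V ∧
      (∃ p : ℕ → ℕ, PreciseQ.PolyBounded p ∧ ∀ n, |c n - s n| ≥ 1 / 2 ^ p n) ∧
      ∀ (x : List Bool) (w : Fin (V x).nProof → Bool),
        (V x).acceptProb w ≥ c x.length ∨ (V x).acceptProb w ≤ s x.length := by
  open PreciseQ in
  obtain ⟨c₀, s₀, V, hV⟩ := hL
  obtain ⟨p, ⟨Q, hQ⟩, hgap⟩ := hV.gap
  obtain ⟨hs₀, z, hz, hzs⟩ := hV.polyTime_s
  obtain ⟨P, hP⟩ := hV.uniform.exists_size_le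
  -- `P` covers the circuit size and `Q` the exponent of the old gap; the two yields the factor four
  -- between that gap and `2 ^ (-q)`.
  obtain ⟨e, he⟩ := exists_eval_le_pow (P + Q + 2)
  obtain ⟨C, hC⟩ := G.exists_separation
  let q : ℕ → ℕ := fun n => (n + 2) ^ (e + 1)
  have hq : ∀ n, P.eval n + Q.eval n + 2 ≤ q n := fun n => by
    have := he n
    simp only [Polynomial.eval_add, Polynomial.eval_ofNat] at this
    exact this.trans (Nat.pow_le_pow_right (by omega) (Nat.le_succ e))
  let s : ℕ → ℝ := fun n => (z (n, q n) + 1) / 2 ^ q n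
  let c : ℕ → ℝ := fun n => s n + 1 / 2 ^ (q n + C * q n + 1)
  have hcs : ∀ n, c n - s n = 1 / 2 ^ (q n + C * q n + 1) := fun n => add_sub_cancel_left _ _
  -- The approximation `z / 2 ^ q` may be too small by `2 ^ (-q)`; adding one to `z` makes up for
  -- it.
  have hs : ∀ n, s₀ n ≤ s n := fun n => by
    have := (abs_le.1 (hzs n (q n))).2
    change _ ≤ ((z (n, q n) : ℝ) + 1) / 2 ^ q n
    rw [add_div]; linarith
  -- Three units of `2 ^ (-q)` are spent: the approximation error of `z`, the rounding up, and the
  -- distance of `c` from `s`.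
  have hc : ∀ n, c n ≤ c₀ n := fun n => by
    have h1 := (abs_le.1 (hzs n (q n))).1
    have h2 : (1 : ℝ) / 2 ^ (q n + C * q n + 1) ≤ 1 / 2 ^ q n :=
      one_div_le_one_div_of_le (by positivity) (pow_le_pow_right₀ (by norm_num) (by omega))
    have h3 : (4 : ℝ) * (1 / 2 ^ q n) ≤ 1 / 2 ^ p n := by
      have h4 : p n + 2 ≤ q n := by have := hq n; have := hQ n; omega
      rw [mul_one_div, div_le_div_iff₀ (by positivity) (by positivity), one_mul]
      calc (4 : ℝ) * 2 ^ p n = 2 ^ (p n + 2) := by rw [pow_add]; ring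
        _ ≤ 2 ^ q n := pow_le_pow_right₀ (by norm_num) h4
    have h5 := hgap n
    have h6 : (0 : ℝ) < 1 / 2 ^ q n := by positivity
    change ((z (n, q n) : ℝ) + 1) / 2 ^ q n + _ ≤ _
    rw [add_div]; linarith
  have hc1 : ∀ n, c n ≤ 1 := fun n => (hc n).trans (hV.polyTime_c.1 n).2
  have hsc : ∀ n, s n ≤ c n := fun n => by
    have := hcs n
    have h6 : (0 : ℝ) < 1 / 2 ^ (q n + C * q n + 1) := by positivity
    linarith
  have hzle : ∀ n, z (n, q n) + 1 ≤ 2 ^ q n := fun n => by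
    have h := (hsc n).trans (hc1 n)
    change ((z (n, q n) : ℝ) + 1) / 2 ^ q n ≤ 1 at h
    rw [div_le_one (by positivity)] at h
    exact_mod_cast h
  have hzlt : ∀ n, z (n, (n + 2) ^ (e + 1)) < 2 ^ ((n + 2) ^ (e + 1) + 1) := fun n => by
    have h : z (n, (n + 2) ^ (e + 1)) + 1 ≤ 2 ^ (n + 2) ^ (e + 1) := hzle n
    rw [pow_succ 2]; omega
  have hpoly : PolyBounded fun n => q n + C * q n + 1 :=
    ⟨(.X + 2) ^ (e + 1) + .C C * (.X + 2) ^ (e + 1) + 1, fun n => by simp [q]⟩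
  refine ⟨c, s, V, ⟨?_, ?_, ⟨_, hpoly, fun n => (hcs n).ge⟩, hV.uniform, hV.qubits, ?_, ?_⟩,
    ⟨_, hpoly, fun n => (hcs n).symm.le.trans (le_abs_self _)⟩, fun x w => ?_⟩
  · exact polyTimeUnitReal_round z e C true hzlt hz c (fun n => by simp [c, s, q]) hc1
  · exact polyTimeUnitReal_round z e C false hzlt hz s (fun n => by simp [s, q])
      fun n => (hsc n).trans (hc1 n)
  · intro x hx
    obtain ⟨y, hy⟩ := hV.complete x hx
    exact ⟨y, (hc _).trans hy⟩
  · exact fun x hx y => (hV.sound x hx y).trans (hs _)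
  · by_cases h : (V x).acceptProb w ≤ s x.length
    · exact .inr h
    · left
      have h1 := hq x.length
      -- A probability above `s` exceeds it by `2 ^ (-C * q)`, more than the distance of `c` from
      -- `s`. No promise on `x` is involved.
      have h2 := hC (V x) w (q x.length) (z (x.length, q x.length) + 1) (by omega)
        ((hP x).trans (by omega)) (hzle _) (by push_cast; exact not_le.1 h)
      push_cast at h2
      have h3 : (1 : ℝ) / 2 ^ (q x.length + C * q x.length + 1) ≤ 1 / 2 ^ (C * q x.length) :=
        one_div_le_one_div_of_le (by positivity) (pow_le_pow_right₀ (by norm_num) (by omega))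
      change s x.length + _ ≤ _
      change s x.length + _ ≤ _ at h2
      linarith
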